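/- A piecewise linear pseudomanifold of dimension $n$ is a compact polyhedron $Y$ in a Euclidean space that has a finite triangulation in which each simplex is a face of some $n$-simplex and each $(n-1)$-simplex is a face of precisely two $n$-simplices. A closed subpolyhedron of $Y$ is a subset of $Y$ that is itself a compact polyhedron; it has codimension at least $2$ if its dimension is at most $n-2$, and codimension $2$ if its dimension is exactly $n-2$ (for $n\le 1$ both mean that it is empty). Lemma. Let $Y$ be a pseudomanifold of dimension $n$ and let $B$ be a closed subpolyhedron of $Y$ of codimension at least $2$. Then there is a finite cover $\{V_i\}$ of $Y-B$ by open subsets of $Y-B$ such that, for each $i$, the set $Y-B-V_i$ is a closed codimension $2$ subpolyhedron of $Y-B$, in the sense that its closure in $Y$ is a closed subpolyhedron of $Y$ of codimension $2$, and $V_i$ is homotopy equivalent to a finite graph (not necessarily connected, possibly empty). -/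

import Mathlib

/-- `K` is a finite (rectilinear) triangulation of the subset `X` of Euclidean space. The faces of
a `Geometry.SimplicialComplex` are its nonempty simplices, given by their sets of vertices, so a
face with `k + 1` vertices is a `k`-simplex. -/
structure IsFiniteTriangulation {N : ℕ}
    (K : Geometry.SimplicialComplex ℝ (EuclideanSpace ℝ (Fin N)))
    (X : Set (EuclideanSpace ℝ (Fin N))) : Prop where
  finite_faces : K.faces.Finite
  space_eq : K.space = X

/-- `Y` is a piecewise linear pseudomanifold of dimension `n`: a compact polyhedron with a finite
triangulation in which each simplex is a face of an `n`-simplex and each `(n - 1)`-simplex is a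
face of precisely two `n`-simplices. (For `n = 0` the last clause is void.) -/
def IsPLPseudomanifold (n : ℕ) {N : ℕ} (Y : Set (EuclideanSpace ℝ (Fin N))) : Prop :=
  ∃ K : Geometry.SimplicialComplex ℝ (EuclideanSpace ℝ (Fin N)),
    IsFiniteTriangulation K Y ∧
    (∀ s ∈ K.faces, ∃ t ∈ K.faces, s ⊆ t ∧ t.card = n + 1) ∧
    (∀ s ∈ K.faces, s.card = n → {t | t ∈ K.faces ∧ s ⊆ t ∧ t.card = n + 1}.ncard = 2)

/-- `P` is a closed subpolyhedron of `Y` (a subset of `Y` that is a compact polyhedron) of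
codimension at least `k` with respect to the dimension `n`: all its simplices have dimension at
most `n - k`. In particular `P` is empty if `n < k`. -/
def IsSubpolyhedronOfCodimGE (k n : ℕ) {N : ℕ} (P Y : Set (EuclideanSpace ℝ (Fin N))) : Prop :=
  P ⊆ Y ∧ ∃ K : Geometry.SimplicialComplex ℝ (EuclideanSpace ℝ (Fin N)),
    IsFiniteTriangulation K P ∧ ∀ s ∈ K.faces, s.card + k ≤ n + 1

/-- `P` is a closed subpolyhedron of `Y` of codimension exactly `k` with respect to the dimension
`n`: its dimension is `n - k` if `k ≤ n`, and it is empty if `n < k`. -/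
def IsSubpolyhedronOfCodim (k n : ℕ) {N : ℕ} (P Y : Set (EuclideanSpace ℝ (Fin N))) : Prop :=
  P ⊆ Y ∧ ∃ K : Geometry.SimplicialComplex ℝ (EuclideanSpace ℝ (Fin N)),
    IsFiniteTriangulation K P ∧ (∀ s ∈ K.faces, s.card + k ≤ n + 1) ∧
    (k ≤ n → ∃ s ∈ K.faces, s.card + k = n + 1)

/-- The space `X` is homotopy equivalent to a finite graph, i.e. to the underlying space of a
finite simplicial complex of dimension at most one (every finite graph, with loops and multiple
edges allowed, becomes one after subdivision of its edges). -/
def HomotopyEquivFiniteGraph (X : Type*) [TopologicalSpace X] : Prop :=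
  ∃ (M : ℕ) (Γ : Geometry.SimplicialComplex ℝ (EuclideanSpace ℝ (Fin M))),
    Γ.faces.Finite ∧ (∀ s ∈ Γ.faces, s.card ≤ 2) ∧
    Nonempty (ContinuousMap.HomotopyEquiv X Γ.space)

open Finset

/-! Triangulate Y so that B becomes a full subcomplex (`exists_triangulation_full`). For a vertex x
off B, let V_x be Y minus all simplices of dimension at most n - 2 that avoid x (`skeletonAway`). B
is made of such simplices, so V_x misses B. A point off B is interior to a simplex that, by
fullness, has a vertex x off B, so the point lies in V_x. The part of Y - B outside V_x has as
closure the subcomplex generated by the removed simplices not inside B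
(`closure_skeletonAway_diff`); it has dimension exactly n - 2 because purity supplies an n-simplex.
If n ≤ 1, then B is empty and Y itself is a graph.

V_x consists of the open star of x and the open simplices of dimension n - 1 and n. Up to homotopy
it is the graph (`dualGraph`) joining x to the (n - 1)-simplices of its link, and each n-simplex
avoiding x to its (n - 1)-faces. Explicit maps in barycentric coordinates go both ways
(`toDualGraph`, `ofDualGraph`); neither composite enlarges supports, so straight-line homotopies
join both to the identities (`nonempty_homotopyEquiv_dualGraph`).

For the triangulation, affine functionals attached to the simplices of Y and B cut space into cells,
indexed by sign vectors. One point chosen in each cell of Y gives the vertices, and chains of the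
face relation give the simplices. The interior of such a simplex lies in its top cell, and B is a
closed union of cells; fullness follows. -/

theorem sum_extend_smul {E : Type*} [DecidableEq E] {V : Type*} [AddCommGroup V] [Module ℝ V] {W s : Finset E}
    (hsW : s ⊆ W) (t : Finset s) (w : s → ℝ) (f : E → V) :
    ∑ q ∈ W, (if hq : q ∈ s then if (⟨q, hq⟩ : s) ∈ t then w ⟨q, hq⟩ else 0 else 0) • f q =
      ∑ e ∈ t, w e • f e := by
  rw [← sum_subset hsW (fun q _ hq => by simp [hq]), ← sum_coe_sort s,
    ← sum_subset (subset_univ t)]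
  · exact sum_congr rfl fun e he => by simp [he]
  · intro e _ he
    simp [he]

/-! ### Sign vectors of a hyperplane arrangement and the order complex of its cells -/

section SignVectors

variable {E : Type*} [NormedAddCommGroup E] [NormedSpace ℝ E] {ι : Type*}

/-- The vector of signs of the values at `x` of a family of affine functionals. -/
noncomputable def signVec (h : ι → E →ᵃ[ℝ] ℝ) (x : E) (i : ι) : SignType :=
  SignType.sign (h i x)

/-- The face relation on sign vectors: `σ` arises from `τ` by setting some entries to zero. -/
def FaceLE (σ τ : ι → SignType) : Prop := ∀ i, σ i = 0 ∨ σ i = τ i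

/-- The sign vectors of the points of `s` are pairwise comparable in the face relation. -/
def IsFaceChain (h : ι → E →ᵃ[ℝ] ℝ) (s : Finset E) : Prop :=
  ∀ p ∈ s, ∀ q ∈ s, FaceLE (signVec h p) (signVec h q) ∨ FaceLE (signVec h q) (signVec h p)

/-- A set is a union of cells of the hyperplane arrangement given by `h`. -/
def IsCellUnion (h : ι → E →ᵃ[ℝ] ℝ) (Z : Set E) : Prop :=
  ∀ x ∈ Z, ∀ y, signVec h y = signVec h x → y ∈ Z

theorem FaceLE.refl (σ : ι → SignType) : FaceLE σ σ := fun _ => Or.inr rfl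

theorem FaceLE.trans {σ τ υ : ι → SignType} (h₁ : FaceLE σ τ) (h₂ : FaceLE τ υ) : FaceLE σ υ := by
  intro i
  rcases h₁ i with h | h
  · exact Or.inl h
  · rw [h]; exact h₂ i

theorem FaceLE.antisymm {σ τ : ι → SignType} (h₁ : FaceLE σ τ) (h₂ : FaceLE τ σ) : σ = τ := by
  funext i
  rcases h₁ i with h | h
  · rcases h₂ i with h' | h'
    · rw [h, h']
    · exact h'.symm
  · exact h

variable {h : ι → E →ᵃ[ℝ] ℝ}

theorem IsFaceChain.subset {s t : Finset E} (ht : IsFaceChain h t) (hst : s ⊆ t) :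
    IsFaceChain h s := fun p hp q hq => ht p (hst hp) q (hst hq)

theorem IsFaceChain.exists_top {s : Finset E} (hs : IsFaceChain h s) (hne : s.Nonempty) :
    ∃ p ∈ s, ∀ q ∈ s, FaceLE (signVec h q) (signVec h p) := by
  classical
  induction hne using Finset.Nonempty.cons_induction with
  | singleton a =>
    exact ⟨a, mem_singleton_self a, fun q hq => by rw [mem_singleton.1 hq]; exact FaceLE.refl _⟩
  | cons a s ha hne ih =>
    obtain ⟨p, hp, hmax⟩ := ih (hs.subset (subset_cons ha))
    rcases hs p (mem_cons_of_mem hp) a (mem_cons_self a s) with hpa | hap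
    · refine ⟨a, mem_cons_self a s, fun q hq => ?_⟩
      rcases mem_cons.1 hq with rfl | hq
      · exact FaceLE.refl _
      · exact (hmax q hq).trans hpa
    · refine ⟨p, mem_cons_of_mem hp, fun q hq => ?_⟩
      rcases mem_cons.1 hq with rfl | hq
      · exact hap
      · exact hmax q hq

theorem AffineMap.map_sum_smul {κ : Type*} (f : E →ᵃ[ℝ] ℝ) (s : Finset κ) (w : κ → ℝ) (p : κ → E)
    (hw : ∑ q ∈ s, w q = 1) : f (∑ q ∈ s, w q • p q) = ∑ q ∈ s, w q * f (p q) := by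
  have hf : ∀ x, f x = f.linear x + f 0 := fun x => by
    have := congrFun f.decomp x
    simpa using this
  rw [hf, map_sum]
  simp_rw [hf (p _), mul_add, sum_add_distrib, ← sum_mul, hw, one_mul, map_smul, smul_eq_mul]

/-- The sign of a nonnegative combination is that of its top point. -/
theorem sign_sum_eq_of_top {s : Finset E} {w : E → ℝ} (hw : ∀ q ∈ s, 0 ≤ w q) {p : E} (hp : p ∈ s)
    (hwp : 0 < w p) (hmax : ∀ q ∈ s, 0 < w q → FaceLE (signVec h q) (signVec h p)) (i : ι) :
    SignType.sign (∑ q ∈ s, w q * h i q) = signVec h p i := by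
  have key : ∀ q ∈ s, w q = 0 ∨ SignType.sign (h i q) = 0 ∨
      SignType.sign (h i q) = SignType.sign (h i p) := by
    intro q hq
    rcases (hw q hq).eq_or_lt with h0 | h0
    · exact Or.inl h0.symm
    · exact Or.inr (hmax q hq h0 i)
  unfold signVec
  rcases lt_trichotomy (h i p) 0 with hlt | heq | hgt
  · rw [sign_neg hlt, sign_neg]
    refine sum_neg' (fun q hq => ?_) ⟨p, hp, mul_neg_of_pos_of_neg hwp hlt⟩
    rcases key q hq with h0 | h0 | h0
    · simp [h0]
    · simp [sign_eq_zero_iff.1 h0]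
    · rw [sign_neg hlt, sign_eq_neg_one_iff] at h0
      exact mul_nonpos_of_nonneg_of_nonpos (hw q hq) h0.le
  · rw [heq, sign_zero, sign_eq_zero_iff]
    refine sum_eq_zero fun q hq => ?_
    rcases key q hq with h0 | h0 | h0
    · simp [h0]
    · simp [sign_eq_zero_iff.1 h0]
    · rw [heq, sign_zero, sign_eq_zero_iff] at h0
      simp [h0]
  · rw [sign_pos hgt, sign_pos]
    refine sum_pos' (fun q hq => ?_) ⟨p, hp, mul_pos hwp hgt⟩
    rcases key q hq with h0 | h0 | h0
    · simp [h0]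
    · simp [sign_eq_zero_iff.1 h0]
    · rw [sign_pos hgt, sign_eq_one_iff] at h0
      exact mul_nonneg (hw q hq) h0.le

/-- Nonnegative weights supported on chains are determined by their total and by the weighted sums
of the functionals. -/
theorem chain_weights_unique {W : Finset E} (hW : Set.InjOn (signVec h) W) :
    ∀ (k : ℕ) (w w' : E → ℝ), (W.filter (w · ≠ 0)).card + (W.filter (w' · ≠ 0)).card ≤ k →
      (∀ q ∈ W, 0 ≤ w q) → (∀ q ∈ W, 0 ≤ w' q) →
      IsFaceChain h (W.filter (w · ≠ 0)) → IsFaceChain h (W.filter (w' · ≠ 0)) →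
      (∑ q ∈ W, w q = ∑ q ∈ W, w' q) →
      (∀ i, ∑ q ∈ W, w q * h i q = ∑ q ∈ W, w' q * h i q) → ∀ q ∈ W, w q = w' q := by
  classical
  intro k
  induction k with
  | zero =>
    intro w w' hc _ _ _ _ _ _ q hq
    have h1 : W.filter (w · ≠ 0) = ∅ := card_eq_zero.1 (by omega)
    have h2 : W.filter (w' · ≠ 0) = ∅ := card_eq_zero.1 (by omega)
    have h3 := filter_eq_empty_iff.1 h1 hq
    have h4 := filter_eq_empty_iff.1 h2 hq
    rw [not_not.1 h3, not_not.1 h4]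
  | succ k ih =>
    intro w w' hc hw hw' hs hs' hsum hh
    rcases (W.filter (w · ≠ 0)).eq_empty_or_nonempty with he | hne
    · have h3 := filter_eq_empty_iff.1 he
      have h0 : ∀ q ∈ W, w q = 0 := fun q hq => not_not.1 (h3 hq)
      rw [sum_eq_zero h0] at hsum
      have := (sum_eq_zero_iff_of_nonneg hw').1 hsum.symm
      intro q hq
      rw [h0 q hq, this q hq]
    rcases (W.filter (w' · ≠ 0)).eq_empty_or_nonempty with he' | hne'
    · have h3 := filter_eq_empty_iff.1 he'
      have h0 : ∀ q ∈ W, w' q = 0 := fun q hq => not_not.1 (h3 hq)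
      rw [sum_eq_zero h0] at hsum
      have := (sum_eq_zero_iff_of_nonneg hw).1 hsum
      intro q hq
      rw [h0 q hq, this q hq]
    obtain ⟨p, hp, hmax⟩ := hs.exists_top hne
    obtain ⟨p', hp', hmax'⟩ := hs'.exists_top hne'
    rw [mem_filter] at hp hp'
    have hwp : 0 < w p := lt_of_le_of_ne (hw p hp.1) (Ne.symm hp.2)
    have hwp' : 0 < w' p' := lt_of_le_of_ne (hw' p' hp'.1) (Ne.symm hp'.2)
    -- The signs of the weighted sums are the sign vector of the top point of the support, so both
    -- supports have the same top.
    obtain rfl : p = p' := by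
      refine hW hp.1 hp'.1 (funext fun i => ?_)
      rw [← sign_sum_eq_of_top hw hp.1 hwp
          (fun q hq h0 => hmax q (mem_filter.2 ⟨hq, h0.ne'⟩)) i,
        ← sign_sum_eq_of_top hw' hp'.1 hwp'
          (fun q hq h0 => hmax' q (mem_filter.2 ⟨hq, h0.ne'⟩)) i, hh]
    -- Subtracting the smaller top weight from both families preserves the hypotheses and removes p
    -- from at least one support.
    set m := min (w p) (w' p) with hm
    have hmpos : 0 < m := lt_min hwp hwp'
    let v : E → ℝ := fun q => w q - if q = p then m else 0
    let v' : E → ℝ := fun q => w' q - if q = p then m else 0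
    have sub : W.filter (v · ≠ 0) ⊆ W.filter (w · ≠ 0) := by
      intro q hq
      rw [mem_filter] at hq ⊢
      refine ⟨hq.1, fun h0 => ?_⟩
      by_cases hqp : q = p
      · subst hqp; exact hp.2 h0
      · exact hq.2 (by simp [v, hqp, h0])
    have sub' : W.filter (v' · ≠ 0) ⊆ W.filter (w' · ≠ 0) := by
      intro q hq
      rw [mem_filter] at hq ⊢
      refine ⟨hq.1, fun h0 => ?_⟩
      by_cases hqp : q = p
      · subst hqp; exact hp'.2 h0
      · exact hq.2 (by simp [v', hqp, h0])
    have hcard : (W.filter (v · ≠ 0)).card + (W.filter (v' · ≠ 0)).card ≤ k := by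
      have c1 := card_le_card sub
      have c2 := card_le_card sub'
      rcases min_choice (w p) (w' p) with hmin | hmin
      · have : W.filter (v · ≠ 0) ⊂ W.filter (w · ≠ 0) := by
          refine (ssubset_iff_of_subset sub).2 ⟨p, mem_filter.2 hp, fun hq => ?_⟩
          exact (mem_filter.1 hq).2 (by simp [v, hm, hmin])
        have := card_lt_card this
        omega
      · have : W.filter (v' · ≠ 0) ⊂ W.filter (w' · ≠ 0) := by
          refine (ssubset_iff_of_subset sub').2 ⟨p, mem_filter.2 hp', fun hq => ?_⟩
          exact (mem_filter.1 hq).2 (by simp [v', hm, hmin])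
        have := card_lt_card this
        omega
    have main := ih v v' hcard
      (fun q hq => by
        by_cases hqp : q = p
        · simp [v, hqp, hm]
        · simpa [v, hqp] using hw q hq)
      (fun q hq => by
        by_cases hqp : q = p
        · simp [v', hqp, hm]
        · simpa [v', hqp] using hw' q hq)
      (hs.subset sub) (hs'.subset sub')
      (by simp only [v, v', sum_sub_distrib, hsum])
      (fun i => by simp only [v, v', sub_mul, sum_sub_distrib, hh])
    intro q hq
    simpa [v, v'] using main q hq

/-- Two convex representations of a point over chains have the same weights. -/
theorem chain_weights_eq {W : Finset E} (hW : Set.InjOn (signVec h) W) {w w' : E → ℝ}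
    (hw : ∀ q ∈ W, 0 ≤ w q) (hw' : ∀ q ∈ W, 0 ≤ w' q)
    (hs : IsFaceChain h (W.filter (w · ≠ 0))) (hs' : IsFaceChain h (W.filter (w' · ≠ 0)))
    (h1 : ∑ q ∈ W, w q = 1) (h1' : ∑ q ∈ W, w' q = 1)
    (hx : ∑ q ∈ W, w q • q = ∑ q ∈ W, w' q • q) : ∀ q ∈ W, w q = w' q :=
  chain_weights_unique hW _ w w' le_rfl hw hw' hs hs' (h1.trans h1'.symm) fun i => by
    rw [← (h i).map_sum_smul W w (fun q => q) h1, ← (h i).map_sum_smul W w' (fun q => q) h1', hx]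

/-- The positive and negative parts of an affine dependence are nonnegative weights on the chain
with equal totals and equal weighted sums, so they coincide by `chain_weights_unique` and the
dependence vanishes. -/
theorem IsFaceChain.affineIndependent {W s : Finset E} (hW : Set.InjOn (signVec h) W)
    (hsW : s ⊆ W) (hs : IsFaceChain h s) : AffineIndependent ℝ ((↑) : s → E) := by
  classical
  rw [affineIndependent_iff]
  intro t w hw hwp
  let a : E → ℝ := fun q => if hq : q ∈ s then if (⟨q, hq⟩ : s) ∈ t then w ⟨q, hq⟩ else 0 else 0
  have ha : ∀ q, a q ≠ 0 → q ∈ s := by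
    intro q hq
    by_contra hqs
    exact hq (by simp [a, hqs])
  have e1 : ∑ q ∈ W, a q = 0 := by
    have := sum_extend_smul hsW t w (fun _ => (1 : ℝ))
    simpa [a, hw] using this
  have e2 : ∑ q ∈ W, a q • q = 0 := by
    exact (sum_extend_smul hsW t w fun q => q).trans hwp
  have e3 : ∀ i, ∑ q ∈ W, a q * h i q = 0 := by
    intro i
    have hf : ∀ x, h i x = (h i).linear x + h i 0 := fun x => by
      have := congrFun (h i).decomp x
      simpa using this
    have h2 := congrArg (h i).linear e2
    rw [map_sum, map_zero] at h2
    have h3 : ∀ q, a q * h i q = (h i).linear (a q • q) + a q * h i 0 := fun q => by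
      rw [hf q, map_smul, smul_eq_mul, mul_add]
    rw [sum_congr rfl fun q _ => h3 q, sum_add_distrib, h2, ← sum_mul, e1, zero_mul, add_zero]
  have pm : ∀ q, a q = (a q)⁺ - (a q)⁻ := fun q => (posPart_sub_negPart _).symm
  have key := chain_weights_unique hW _ (fun q => (a q)⁺) (fun q => (a q)⁻) le_rfl
    (fun q _ => posPart_nonneg _) (fun q _ => negPart_nonneg _)
    (hs.subset fun q hq => ha q fun h0 => (mem_filter.1 hq).2 (by simp [h0]))
    (hs.subset fun q hq => ha q fun h0 => (mem_filter.1 hq).2 (by simp [h0]))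
    (by rw [← sub_eq_zero, ← sum_sub_distrib, ← e1]; simp [posPart_sub_negPart])
    (fun i => by
      rw [← sub_eq_zero, ← sum_sub_distrib, ← e3 i]
      simp [← sub_mul, posPart_sub_negPart])
  intro e he
  have := key e (hsW e.2)
  have h0 : a e = 0 := by rw [pm, this, sub_self]
  simpa [a, he] using h0

theorem exists_weights_of_mem_convexHull {W s : Finset E} (hsW : s ⊆ W) {x : E}
    (hx : x ∈ convexHull ℝ (s : Set E)) :
    ∃ w : E → ℝ, (∀ q, 0 ≤ w q) ∧ (∀ q, w q ≠ 0 → q ∈ s) ∧ ∑ q ∈ W, w q = 1 ∧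
      ∑ q ∈ W, w q • q = x := by
  classical
  obtain ⟨w, h0, h1, h2⟩ := Finset.mem_convexHull'.1 hx
  refine ⟨fun q => if q ∈ s then w q else 0, fun q => ?_, fun q hq => ?_, ?_, ?_⟩
  · dsimp only
    split_ifs with hq
    · exact h0 q hq
    · exact le_rfl
  · by_contra hqs
    exact hq (if_neg hqs)
  · rw [← h1, ← sum_subset hsW (fun q _ hq => if_neg hq)]
    exact sum_congr rfl fun q hq => if_pos hq
  · rw [← h2, ← sum_subset hsW (fun q _ hq => by simp [hq])]
    exact sum_congr rfl fun q hq => by simp [hq]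

/-- The order complex of the cells of a hyperplane arrangement that are represented by the
points of `W`. -/
def orderComplex (h : ι → E →ᵃ[ℝ] ℝ) (W : Finset E) (hW : Set.InjOn (signVec h) W) :
    Geometry.SimplicialComplex ℝ E where
  faces := {s | s.Nonempty ∧ s ⊆ W ∧ IsFaceChain h s}
  isRelLowerSet_faces := fun _ hs =>
    ⟨hs.1, fun _ ht hne => ⟨hne, ht.trans hs.2.1, hs.2.2.subset ht⟩⟩
  indep := fun hs => hs.2.2.affineIndependent hW hs.2.1
  inter_subset_convexHull := by
    classical
    rintro s t ⟨-, hsW, hs⟩ ⟨-, htW, ht⟩ x ⟨hxs, hxt⟩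
    obtain ⟨w, w0, ws, w1, wx⟩ := exists_weights_of_mem_convexHull hsW hxs
    obtain ⟨v, v0, vt, v1, vx⟩ := exists_weights_of_mem_convexHull htW hxt
    have key := chain_weights_eq hW (fun q _ => w0 q) (fun q _ => v0 q)
      (hs.subset fun q hq => ws q (mem_filter.1 hq).2)
      (ht.subset fun q hq => vt q (mem_filter.1 hq).2) w1 v1 (wx.trans vx.symm)
    rw [← coe_inter, Finset.mem_convexHull']
    have hz : ∀ q ∈ W, q ∉ s ∩ t → w q = 0 := by
      intro q hq hn
      by_contra h0
      exact hn (mem_inter.2 ⟨ws q h0, vt q (key q hq ▸ h0)⟩)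
    have hst : s ∩ t ⊆ W := inter_subset_left.trans hsW
    refine ⟨w, fun q _ => w0 q, ?_, ?_⟩
    · rw [← w1]; exact sum_subset hst hz
    · rw [← wx]; exact sum_subset hst fun q hq hn => by rw [hz q hq hn, zero_smul]

end SignVectors

/-! ### Cells of a compact union, and simplices as unions of cells -/

section Cells

variable {E : Type*} [NormedAddCommGroup E] [NormedSpace ℝ E] {ι : Type*}
  {h : ι → E →ᵃ[ℝ] ℝ}

theorem AffineMap.apply_lineMap_real (f : E →ᵃ[ℝ] ℝ) (x y : E) (r : ℝ) :
    f (AffineMap.lineMap x y r) = f x + r * (f y - f x) := by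
  rw [AffineMap.apply_lineMap, AffineMap.lineMap_apply]
  simp [add_comm]

theorem signVec_lineMap_of_faceLE {x y : E} (hyx : FaceLE (signVec h y) (signVec h x)) {r : ℝ}
    (h0 : 0 < r) (h1 : r ≤ 1) : signVec h (AffineMap.lineMap y x r) = signVec h x := by
  funext i
  have key := hyx i
  unfold signVec at key ⊢
  rw [AffineMap.apply_lineMap_real]
  rcases lt_trichotomy (h i x) 0 with hlt | heq | hgt
  · rw [sign_neg hlt, sign_eq_zero_iff, sign_eq_neg_one_iff] at key
    rw [sign_neg hlt, sign_neg]
    rcases key with hk | hk <;> nlinarith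
  · rw [heq, sign_zero, or_self, sign_eq_zero_iff] at key
    simp [heq, key]
  · rw [sign_pos hgt, sign_eq_zero_iff, sign_eq_one_iff] at key
    rw [sign_pos hgt, sign_pos]
    rcases key with hk | hk <;> nlinarith

/-- A closed union of cells contains the closure of each of its cells. -/
theorem IsCellUnion.mem_of_faceLE {Z : Set E} (hZ : IsCellUnion h Z) (hc : IsClosed Z) {x y : E}
    (hx : x ∈ Z) (hyx : FaceLE (signVec h y) (signVec h x)) : y ∈ Z := by
  have ht : Filter.Tendsto (AffineMap.lineMap y x : ℝ → E) (nhdsWithin 0 (Set.Ioi 0)) (nhds y) := by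
    have hcont : Continuous (AffineMap.lineMap y x : ℝ → E) := AffineMap.lineMap_continuous
    have := hcont.tendsto 0
    rw [AffineMap.lineMap_apply_zero] at this
    exact this.mono_left nhdsWithin_le_nhds
  refine hc.mem_of_tendsto ht ?_
  filter_upwards [Ioo_mem_nhdsGT (zero_lt_one' ℝ)] with r hr
  exact hZ x hx _ (signVec_lineMap_of_faceLE hyx hr.1 hr.2.le)

/-- A ray inside a cell of a compact union of cells leaves the cell through a proper face. -/
theorem IsCellUnion.exists_exit [Finite ι] {Z : Set E} (hZ : IsCellUnion h Z) (hc : IsCompact Z)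
    {x b : E} (hx : x ∈ Z) (hbx : signVec h b = signVec h x) (hne : b ≠ x) :
    ∃ y ∈ Z, FaceLE (signVec h y) (signVec h x) ∧ signVec h y ≠ signVec h x ∧
      x ∈ segment ℝ b y := by
  have hg : ∀ i, Continuous fun r : ℝ => h i (AffineMap.lineMap b x r) := fun i => by
    simp_rw [AffineMap.apply_lineMap_real]
    fun_prop
  -- The parameters at which the line is in the closed cell. This set is closed, and bounded because
  -- the closed cell lies in the compact Z; its supremum gives the exit point.
  let R : Set ℝ := {r | FaceLE (signVec h (AffineMap.lineMap b x r)) (signVec h x)}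
  have hRclosed : IsClosed R := by
    have : R = ⋂ i, {r | signVec h (AffineMap.lineMap b x r) i = 0 ∨
        signVec h (AffineMap.lineMap b x r) i = signVec h x i} := by
      ext r; simp [R, FaceLE]
    rw [this]
    refine isClosed_iInter fun i => ?_
    unfold signVec
    rcases lt_trichotomy (h i x) 0 with hlt | heq | hgt
    · convert isClosed_le (hg i) (continuous_const (y := (0 : ℝ))) using 3 with r
      rw [sign_neg hlt, sign_eq_zero_iff, sign_eq_neg_one_iff, or_comm, le_iff_lt_or_eq]
    · simp_rw [heq, sign_zero, or_self, sign_eq_zero_iff]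
      exact isClosed_eq (hg i) continuous_const
    · convert isClosed_le (continuous_const (y := (0 : ℝ))) (hg i) using 3 with r
      rw [sign_pos hgt, sign_eq_zero_iff, sign_eq_one_iff, or_comm, le_iff_lt_or_eq, eq_comm]
  have h1R : (1 : ℝ) ∈ R := by
    simp only [R, Set.mem_ofPred_eq, AffineMap.lineMap_apply_one]
    exact FaceLE.refl _
  have hRbdd : BddAbove R := by
    obtain ⟨C, hC⟩ := hc.isBounded.exists_norm_le
    have hpos : 0 < ‖x - b‖ := norm_pos_iff.2 (sub_ne_zero.2 hne.symm)
    refine ⟨(C + ‖b‖) / ‖x - b‖, fun r hr => ?_⟩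
    have hy := hC _ (hZ.mem_of_faceLE hc.isClosed hx hr)
    rw [le_div_iff₀ hpos]
    have e : r • (x - b) = AffineMap.lineMap b x r - b := by
      simp [AffineMap.lineMap_apply]
    calc r * ‖x - b‖ ≤ ‖r • (x - b)‖ := by
          rw [norm_smul]; exact mul_le_mul_of_nonneg_right (le_abs_self r) hpos.le
      _ ≤ ‖AffineMap.lineMap b x r‖ + ‖b‖ := by rw [e]; exact norm_sub_le _ _
      _ ≤ C + ‖b‖ := by gcongr
  set r := sSup R with hr
  have hrR : r ∈ R := hRclosed.csSup_mem ⟨1, h1R⟩ hRbdd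
  have hr1 : 1 ≤ r := le_csSup hRbdd h1R
  refine ⟨AffineMap.lineMap b x r, hZ.mem_of_faceLE hc.isClosed hx hrR, hrR, fun heq => ?_, ?_⟩
  -- If the exit point were still in the open cell, strict signs would persist slightly beyond it,
  -- while functionals vanishing at x also vanish at b and hence on the whole line. This contradicts
  -- the supremum.
  · have hev : ∀ᶠ r' in nhds r, ∀ i,
        signVec h (AffineMap.lineMap b x r') i = signVec h x i := by
      rw [Filter.eventually_all]
      intro i
      have hi := congrFun heq i
      have hb := congrFun hbx i
      unfold signVec at hi hb ⊢
      rcases lt_trichotomy (h i x) 0 with hlt | hz | hgt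
      · rw [sign_neg hlt, sign_eq_neg_one_iff] at hi
        filter_upwards [(hg i).continuousAt.eventually_lt_const hi] with r' hr'
        rw [sign_neg hlt, sign_neg hr']
      · rw [hz, sign_zero, sign_eq_zero_iff] at hb
        refine Filter.Eventually.of_forall fun r' => ?_
        rw [AffineMap.apply_lineMap_real, hz, hb]
        simp
      · rw [sign_pos hgt, sign_eq_one_iff] at hi
        filter_upwards [(hg i).continuousAt.eventually_const_lt hi] with r' hr'
        rw [sign_pos hgt, sign_pos hr']
    obtain ⟨r', hr', hlt⟩ :=
      ((hev.filter_mono nhdsWithin_le_nhds).and (self_mem_nhdsWithin (s := Set.Ioi r))).exists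
    exact absurd (le_csSup hRbdd (show r' ∈ R from fun i => Or.inr (hr' i))) (not_le.2 hlt)
  · have hr0 : r ≠ 0 := by positivity
    refine ⟨1 - r⁻¹, r⁻¹, sub_nonneg.2 (inv_le_one_of_one_le₀ hr1), by positivity, by ring, ?_⟩
    rw [AffineMap.lineMap_apply, vsub_eq_sub, vadd_eq_add, smul_add, smul_smul, inv_mul_cancel₀ hr0,
      sub_smul]
    module

/-- Each point of a compact union of cells lies in a simplex of the order complex whose vertices
represent faces of the cell of the point. -/
theorem IsCellUnion.exists_chain [Finite ι] {Z : Set E} (hZ : IsCellUnion h Z) (hc : IsCompact Z)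
    {W : Finset E} (hW : ∀ x ∈ Z, ∃ p ∈ W, signVec h p = signVec h x) :
    ∀ (k : ℕ), ∀ x ∈ Z, {i | signVec h x i ≠ 0}.ncard ≤ k → ∃ s ⊆ W, s.Nonempty ∧ IsFaceChain h s ∧
      (∀ p ∈ s, FaceLE (signVec h p) (signVec h x)) ∧ x ∈ convexHull ℝ (s : Set E) := by
  classical
  intro k
  induction k using Nat.strong_induction_on with
  | _ k ih =>
  intro x hx hk
  obtain ⟨b, hbW, hb⟩ := hW x hx
  by_cases hbx : b = x
  · refine ⟨{b}, by simpa using hbW, singleton_nonempty b, ?_, ?_, by simp [hbx]⟩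
    · intro p hp q hq
      rw [mem_singleton.1 hp, mem_singleton.1 hq]
      exact Or.inl (FaceLE.refl _)
    · intro p hp
      rw [mem_singleton.1 hp, hb]
      exact FaceLE.refl _
  -- The exit point y has fewer nonzero signs. Adding the representative b on top of a chain for y
  -- keeps it a chain, and the hull then contains the segment from b to y, which passes through x.
  · obtain ⟨y, hy, hyx, hyne, hseg⟩ := hZ.exists_exit hc hx hb hbx
    have hlt : {i | signVec h y i ≠ 0}.ncard < {i | signVec h x i ≠ 0}.ncard := by
      refine Set.ncard_lt_ncard ⟨fun i hi => ?_, fun hsub => ?_⟩ (Set.toFinite _)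
      · exact fun h0 => hi ((hyx i).elim id fun e => e.trans h0)
      · refine hyne (funext fun i => (hyx i).elim (fun e => ?_) id)
        rw [e]
        by_contra h0
        exact hsub (Ne.symm h0) e
    obtain ⟨s, hsW, hsne, hs, hsy, hys⟩ := ih _ (hlt.trans_le hk) y hy le_rfl
    have hpb : ∀ p ∈ s, FaceLE (signVec h p) (signVec h b) := fun p hp => by
      rw [hb]; exact (hsy p hp).trans hyx
    refine ⟨insert b s, insert_subset hbW hsW, insert_nonempty b s, ?_, ?_, ?_⟩
    · intro p hp q hq
      rcases mem_insert.1 hp with hp | hp <;> rcases mem_insert.1 hq with hq | hq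
      · rw [hp, hq]
        exact Or.inl (FaceLE.refl _)
      · rw [hp]
        exact Or.inr (hpb q hq)
      · rw [hq]
        exact Or.inl (hpb p hp)
      · exact hs p hp q hq
    · intro p hp
      rw [← hb]
      rcases mem_insert.1 hp with rfl | hp
      · exact FaceLE.refl _
      · exact hpb p hp
    · refine (convex_convexHull ℝ _).segment_subset ?_ ?_ hseg
      · exact subset_convexHull ℝ _ (by simp)
      · exact convexHull_mono (by simp) hys

theorem signVec_sum_eq_of_top {s : Finset E} {w : E → ℝ} (hw : ∀ q ∈ s, 0 ≤ w q)
    (hw1 : ∑ q ∈ s, w q = 1) {p : E} (hp : p ∈ s) (hwp : 0 < w p)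
    (hmax : ∀ q ∈ s, 0 < w q → FaceLE (signVec h q) (signVec h p)) :
    signVec h (∑ q ∈ s, w q • q) = signVec h p := by
  funext i
  rw [← sign_sum_eq_of_top hw hp hwp hmax i, ← (h i).map_sum_smul s w (fun q => q) hw1]
  rfl

/-- Extend t to an affine basis: the simplex is the set where all barycentric coordinates are
nonnegative and those of the added points vanish, a condition on signs only. -/
theorem exists_signVec_convexHull [FiniteDimensional ℝ E] {t : Finset E}
    (ht : AffineIndependent ℝ ((↑) : t → E)) :
    ∃ H : Set (E →ᵃ[ℝ] ℝ), H.Finite ∧ ∀ x y : E,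
      (∀ f ∈ H, SignType.sign (f x) = SignType.sign (f y)) →
      x ∈ convexHull ℝ (t : Set E) → y ∈ convexHull ℝ (t : Set E) := by
  classical
  obtain ⟨s, hts, hs, hspan⟩ := exists_subset_affineIndependent_affineSpan_eq_top (k := ℝ)
    (s := (t : Set E)) ht
  let b : AffineBasis s ℝ E := ⟨(↑), hs, by simpa using hspan⟩
  have hfin : Finite s := finite_set_of_fin_dim_affineIndependent ℝ hs
  have : Fintype s := Fintype.ofFinite s
  have hbc : ∀ i : s, b i = i := fun _ => rfl
  have char : ∀ x, x ∈ convexHull ℝ (t : Set E) ↔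
      ∀ i : s, 0 ≤ b.coord i x ∧ ((i : E) ∉ t → b.coord i x = 0) := by
    intro x
    constructor
    · intro hx i
      obtain ⟨w, h0, h1, rfl⟩ := Finset.mem_convexHull'.1 hx
      rw [(b.coord i).map_sum_smul t w (fun q => q) h1]
      have hcoord : ∀ q ∈ t, b.coord i q = if (i : E) = q then 1 else 0 := by
        intro q hq
        have := b.coord_apply i ⟨q, hts hq⟩
        rw [hbc] at this
        rw [this]
        simp [Subtype.ext_iff]
      rw [sum_congr rfl fun q hq => by rw [hcoord q hq]]
      simp only [mul_ite, mul_one, mul_zero, sum_ite_eq]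
      split_ifs with hi
      · exact ⟨h0 _ hi, fun hn => absurd hi hn⟩
      · exact ⟨le_rfl, fun _ => rfl⟩
    · intro hx
      rw [← b.linear_combination_coord_eq_self x]
      have hs1 := b.sum_coord_apply_eq_one x
      have h2 : ∑ i : s, b.coord i x • b i =
          ∑ i ∈ univ.filter (fun i : s => (i : E) ∈ t), b.coord i x • b i := by
        symm
        refine sum_subset (filter_subset _ _) fun i _ hi => ?_
        rw [(hx i).2 (by simpa using hi), zero_smul]
      have h3 : ∑ i : s, b.coord i x =
          ∑ i ∈ univ.filter (fun i : s => (i : E) ∈ t), b.coord i x := by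
        symm
        refine sum_subset (filter_subset _ _) fun i _ hi => ?_
        rw [(hx i).2 (by simpa using hi)]
      rw [h2]
      refine (convex_convexHull ℝ _).sum_mem (fun i _ => (hx i).1) (h3 ▸ hs1) fun i hi => ?_
      exact subset_convexHull ℝ _ (mem_filter.1 hi).2
  refine ⟨Set.range b.coord, Set.finite_range _, fun x y hxy hx => ?_⟩
  rw [char] at hx ⊢
  intro i
  have e := hxy (b.coord i) ⟨i, rfl⟩
  refine ⟨?_, fun hi => ?_⟩
  · rw [← sign_nonneg_iff, ← e, sign_nonneg_iff]
    exact (hx i).1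
  · rw [← sign_eq_zero_iff, ← e, sign_eq_zero_iff]
    exact (hx i).2 hi

end Cells

/-! ### A triangulation with a given full subcomplex -/

section Triangulation

variable {E : Type*} [NormedAddCommGroup E] [NormedSpace ℝ E]

theorem Geometry.SimplicialComplex.isCompact_space {K : Geometry.SimplicialComplex ℝ E}
    (hK : K.faces.Finite) : IsCompact K.space :=
  hK.isCompact_biUnion fun s _ => s.finite_toSet.isCompact_convexHull ℝ

theorem IsCellUnion.space {ι : Type*} {h : ι → E →ᵃ[ℝ] ℝ} {K : Geometry.SimplicialComplex ℝ E}
    (hK : ∀ t ∈ K.faces, IsCellUnion h (convexHull ℝ (t : Set E))) : IsCellUnion h K.space := by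
  intro x hx y hxy
  rw [Geometry.SimplicialComplex.mem_space_iff] at hx ⊢
  obtain ⟨t, ht, hxt⟩ := hx
  exact ⟨t, ht, hK t ht x hxt y hxy⟩

theorem exists_isCellUnion_faces [FiniteDimensional ℝ E] (K L : Geometry.SimplicialComplex ℝ E)
    (hK : K.faces.Finite) (hL : L.faces.Finite) :
    ∃ H : Set (E →ᵃ[ℝ] ℝ), H.Finite ∧
      (∀ t ∈ K.faces, IsCellUnion (fun f : H => (f : E →ᵃ[ℝ] ℝ)) (convexHull ℝ (t : Set E))) ∧
      (∀ t ∈ L.faces, IsCellUnion (fun f : H => (f : E →ᵃ[ℝ] ℝ)) (convexHull ℝ (t : Set E))) := by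
  classical
  have hind : ∀ t ∈ K.faces ∪ L.faces, AffineIndependent ℝ ((↑) : t → E) := fun t ht =>
    ht.elim (fun h => K.indep h) (fun h => L.indep h)
  choose! H hfin hH using fun t ht => exists_signVec_convexHull (hind t ht)
  have key : ∀ t ∈ K.faces ∪ L.faces,
      IsCellUnion (fun f : ↥(⋃ t ∈ K.faces ∪ L.faces, H t) => (f : E →ᵃ[ℝ] ℝ))
        (convexHull ℝ (t : Set E)) := fun t ht x hx y hxy =>
    hH t ht x y (fun f hf => (congrFun hxy ⟨f, Set.mem_biUnion ht hf⟩).symm) hx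
  exact ⟨⋃ t ∈ K.faces ∪ L.faces, H t, (hK.union hL).biUnion hfin,
    fun t ht => key t (Or.inl ht), fun t ht => key t (Or.inr ht)⟩

/-- A compact polyhedron has a triangulation in which a given subpolyhedron is a full
subcomplex. -/
theorem exists_triangulation_full [FiniteDimensional ℝ E] (K L : Geometry.SimplicialComplex ℝ E)
    (hK : K.faces.Finite) (hL : L.faces.Finite) :
    ∃ T : Geometry.SimplicialComplex ℝ E, T.faces.Finite ∧ T.space = K.space ∧
      (∀ s ∈ T.faces, ∃ t ∈ K.faces, (s : Set E) ⊆ convexHull ℝ (t : Set E)) ∧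
      (∀ s ∈ T.faces, ∀ w : E → ℝ, (∀ q ∈ s, 0 < w q) → ∑ q ∈ s, w q = 1 →
        ∑ q ∈ s, w q • q ∈ L.space →
        ∃ t ∈ L.faces, (s : Set E) ⊆ convexHull ℝ (t : Set E)) ∧
      (∀ s ∈ T.faces, (s : Set E) ⊆ L.space → convexHull ℝ (s : Set E) ⊆ L.space) := by
  classical
  obtain ⟨H, hHfin, hHK, hHL⟩ := exists_isCellUnion_faces K L hK hL
  have : Finite H := hHfin
  set h : H → E →ᵃ[ℝ] ℝ := fun f => (f : E →ᵃ[ℝ] ℝ) with hh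
  have hY := IsCellUnion.space hHK
  have hB := IsCellUnion.space hHL
  have hYc := K.isCompact_space hK
  have hfin : (signVec h '' K.space).Finite := Set.toFinite _
  -- One representative for each cell met by the polyhedron; only finitely many sign vectors exist.
  obtain ⟨W, hWY, hWimg, hWinj⟩ : ∃ W : Finset E, (W : Set E) ⊆ K.space ∧
      signVec h '' (W : Set E) = signVec h '' K.space ∧ Set.InjOn (signVec h) W := by
    obtain ⟨u, hu, hbij⟩ := Set.exists_subset_bijOn K.space (signVec h)
    have hufin : u.Finite := Set.Finite.of_finite_image (hbij.image_eq ▸ hfin) hbij.injOn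
    refine ⟨hufin.toFinset, by simpa using hu, by simpa using hbij.image_eq,
      by simpa using hbij.injOn⟩
  have hW : ∀ x ∈ K.space, ∃ p ∈ W, signVec h p = signVec h x := fun x hx => by
    have : signVec h x ∈ signVec h '' (W : Set E) := hWimg ▸ Set.mem_image_of_mem _ hx
    simpa using this
  have hclosed : ∀ t : Finset E, IsClosed (convexHull ℝ (t : Set E)) := fun t =>
    (t.finite_toSet.isCompact_convexHull ℝ).isClosed
  have htop : ∀ (M : Geometry.SimplicialComplex ℝ E),
      (∀ t ∈ M.faces, IsCellUnion h (convexHull ℝ (t : Set E))) → ∀ (s : Finset E) (p : E),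
      p ∈ M.space → (∀ q ∈ s, FaceLE (signVec h q) (signVec h p)) →
      ∃ t ∈ M.faces, (s : Set E) ⊆ convexHull ℝ (t : Set E) := by
    intro M hM s p hp hs
    obtain ⟨t, ht, hpt⟩ := Geometry.SimplicialComplex.mem_space_iff.1 hp
    exact ⟨t, ht, fun q hq => (hM t ht).mem_of_faceLE (hclosed t) hpt (hs q hq)⟩
  have hhull : ∀ (Z : Set E), IsCellUnion h Z → ∀ s, IsFaceChain h s → (s : Set E) ⊆ Z →
      convexHull ℝ (s : Set E) ⊆ Z := by
    intro Z hZ s hs hsZ x hx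
    obtain ⟨w, w0, ws, w1, rfl⟩ := exists_weights_of_mem_convexHull (Subset.refl s) hx
    have hne : (s.filter (w · ≠ 0)).Nonempty := by
      by_contra hn
      rw [not_nonempty_iff_eq_empty, filter_eq_empty_iff] at hn
      rw [sum_eq_zero fun q hq => not_not.1 (hn hq)] at w1
      exact zero_ne_one w1
    obtain ⟨p, hp, hmax⟩ := (hs.subset (filter_subset (w · ≠ 0) s)).exists_top hne
    rw [mem_filter] at hp
    exact hZ p (hsZ hp.1) _ (signVec_sum_eq_of_top (fun q _ => w0 q) w1 hp.1
      (lt_of_le_of_ne (w0 p) (Ne.symm hp.2))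
      fun q hq hq0 => hmax q (mem_filter.2 ⟨hq, hq0.ne'⟩))
  refine ⟨orderComplex h W hWinj, ?_, ?_, ?_, ?_, ?_⟩
  · exact (finite_toSet W.powerset).subset fun s hs => by simpa using hs.2.1
  · ext x
    rw [Geometry.SimplicialComplex.mem_space_iff]
    constructor
    · rintro ⟨s, ⟨-, hsW, hs⟩, hx⟩
      exact hhull _ hY s hs (fun q hq => hWY (hsW hq)) hx
    · intro hx
      obtain ⟨s, hsW, hsne, hs, -, hxs⟩ := hY.exists_chain hYc hW _ x hx le_rfl
      exact ⟨s, ⟨hsne, hsW, hs⟩, hxs⟩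
  · rintro s ⟨hne, hsW, hs⟩
    obtain ⟨p, hp, hmax⟩ := hs.exists_top hne
    exact htop K hHK s p (hWY (hsW hp)) hmax
  · rintro s ⟨hne, hsW, hs⟩ w w0 w1 hx
    obtain ⟨p, hp, hmax⟩ := hs.exists_top hne
    -- The interior point has the sign vector of the top vertex p, so p lies in a simplex of L;
    -- being closed and a union of cells, this simplex contains the lower vertices too.
    refine htop L hHL s p (hB _ hx p ?_) hmax
    exact (signVec_sum_eq_of_top (fun q hq => (w0 q hq).le) w1 hp (w0 p hp)
      fun q hq _ => hmax q hq).symm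
  · rintro s ⟨-, -, hs⟩ hsL
    exact hhull _ hB s hs hsL

end Triangulation

/-! ### Geometric realization in barycentric coordinates -/

section Realization

variable {κ : Type*} [Fintype κ]

/-- The support of a weight function, as a finset. -/
noncomputable def weightSupport (w : κ → ℝ) : Finset κ := univ.filter (w · ≠ 0)

/-- The geometric realization of an abstract simplicial complex in barycentric coordinates. -/
def realization (F : PreAbstractSimplicialComplex κ) : Set (κ → ℝ) :=
  {w | (∀ i, 0 ≤ w i) ∧ ∑ i, w i = 1 ∧ weightSupport w ∈ F.faces}

@[simp]
theorem mem_weightSupport {w : κ → ℝ} {i : κ} : i ∈ weightSupport w ↔ w i ≠ 0 := by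
  simp [weightSupport]

theorem PreAbstractSimplicialComplex.mem_of_subset {κ : Type*} {F : PreAbstractSimplicialComplex κ}
    {s t : Finset κ} (ht : t ∈ F.faces) (hst : s ⊆ t) (hs : s.Nonempty) : s ∈ F.faces :=
  (F.isRelLowerSet_faces ht).2 hst hs

theorem weightSupport_nonempty {w : κ → ℝ} (hw : ∑ i, w i = 1) : (weightSupport w).Nonempty := by
  by_contra h
  rw [not_nonempty_iff_eq_empty, weightSupport, filter_eq_empty_iff] at h
  rw [sum_eq_zero fun i hi => not_not.1 (h hi)] at hw
  exact zero_ne_one hw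

theorem sum_weightSupport {V : Type*} [AddCommGroup V] [Module ℝ V] (w : κ → ℝ) (f : κ → V)
    {s : Finset κ} (hs : weightSupport w ⊆ s) : ∑ i ∈ s, w i • f i = ∑ i, w i • f i := by
  refine sum_subset (subset_univ s) fun i _ hi => ?_
  have : w i = 0 := by
    by_contra h0
    exact hi (hs (mem_weightSupport.2 h0))
  rw [this, zero_smul]

theorem sum_weightSupport' (w : κ → ℝ) {s : Finset κ} (hs : weightSupport w ⊆ s) :
    ∑ i ∈ s, w i = ∑ i, w i := by
  simpa using sum_weightSupport w (fun _ => (1 : ℝ)) hs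

theorem isCompact_realization (F : PreAbstractSimplicialComplex κ) :
    IsCompact (realization F) := by
  classical
  have hfin : F.faces.Finite := Set.toFinite _
  have : realization F = ⋃ s ∈ F.faces, (stdSimplex ℝ κ ∩ {w | ∀ i, i ∉ s → w i = 0}) := by
    ext w
    simp only [Set.mem_iUnion]
    constructor
    · rintro ⟨h0, h1, hs⟩
      exact ⟨_, hs, ⟨h0, h1⟩, fun i hi => by simpa using hi⟩
    · rintro ⟨s, hs, ⟨h0, h1⟩, hw⟩
      refine ⟨h0, h1, PreAbstractSimplicialComplex.mem_of_subset hs (fun i hi => ?_)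
        (weightSupport_nonempty h1)⟩
      by_contra his
      exact mem_weightSupport.1 hi (hw i his)
  rw [this]
  refine hfin.isCompact_biUnion fun s _ => (isCompact_stdSimplex ℝ κ).inter_right ?_
  have : {w : κ → ℝ | ∀ i, i ∉ s → w i = 0} = ⋂ i, ⋂ (_ : i ∉ s), {w | w i = 0} := by
    ext w; simp
  rw [this]
  exact isClosed_iInter fun i => isClosed_iInter fun _ =>
    isClosed_eq (continuous_apply i) continuous_const

variable {E : Type*} [NormedAddCommGroup E] [NormedSpace ℝ E]
  {T : Geometry.SimplicialComplex ℝ E} {p : κ ↪ E}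

theorem weights_eq_of_sum_eq {s : Finset κ} (hs : s.map p ∈ T.faces) {w v : κ → ℝ}
    (hw : weightSupport w ⊆ s) (hv : weightSupport v ⊆ s) (h1 : ∑ i, w i = ∑ i, v i)
    (h2 : ∑ i, w i • p i = ∑ i, v i • p i) : w = v := by
  have key := (T.indep hs).eq_of_sum_eq_sum_subtype
    (w₁ := Function.extend p w 0) (w₂ := Function.extend p v 0)
    (by simp [p.injective.extend_apply, sum_weightSupport' w hw, sum_weightSupport' v hv, h1])
    (by simp [p.injective.extend_apply, sum_weightSupport w _ hw, sum_weightSupport v _ hv, h2])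
  funext i
  by_cases hi : i ∈ s
  · simpa [p.injective.extend_apply] using key (p i) (mem_map_of_mem p hi)
  · have hwi : w i = 0 := by
      by_contra h0
      exact hi (hw (mem_weightSupport.2 h0))
    have hvi : v i = 0 := by
      by_contra h0
      exact hi (hv (mem_weightSupport.2 h0))
    rw [hwi, hvi]

theorem exists_weights_of_mem_convexHull_map {s : Finset κ} {y : E}
    (hy : y ∈ convexHull ℝ (s.map p : Set E)) :
    ∃ v : κ → ℝ, (∀ i, 0 ≤ v i) ∧ ∑ i, v i = 1 ∧ weightSupport v ⊆ s ∧ ∑ i, v i • p i = y := by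
  classical
  obtain ⟨a, a0, a1, ay⟩ := Finset.mem_convexHull'.1 hy
  rw [sum_map] at a1 ay
  have hsub : weightSupport (fun i => if i ∈ s then a (p i) else 0) ⊆ s := by
    intro i hi
    by_contra his
    exact mem_weightSupport.1 hi (if_neg his)
  refine ⟨fun i => if i ∈ s then a (p i) else 0, fun i => ?_, ?_, hsub, ?_⟩
  · dsimp only
    split_ifs with hi
    · exact a0 _ (mem_map_of_mem p hi)
    · exact le_rfl
  · rw [← sum_weightSupport' _ hsub, ← a1]
    exact sum_congr rfl fun i hi => if_pos hi
  · rw [← sum_weightSupport _ _ hsub, ← ay]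
    exact sum_congr rfl fun i hi => by rw [if_pos hi]

theorem sum_mem_convexHull_map {s : Finset κ} {w : κ → ℝ} (h0 : ∀ i, 0 ≤ w i) (h1 : ∑ i, w i = 1)
    (hs : weightSupport w ⊆ s) : ∑ i, w i • p i ∈ convexHull ℝ (s.map p : Set E) := by
  rw [← sum_weightSupport w _ hs]
  refine (convex_convexHull ℝ _).sum_mem (fun i _ => h0 i) ((sum_weightSupport' w hs).trans h1)
    fun i hi => subset_convexHull ℝ _ ?_
  simpa using hi

/-- A point of the realization lies in a simplex iff its support is a face of this simplex. -/
theorem sum_mem_convexHull_map_iff {F : PreAbstractSimplicialComplex κ}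
    (hF : ∀ s ∈ F.faces, s.map p ∈ T.faces) {w : κ → ℝ} (hw : w ∈ realization F) {t : Finset κ}
    (ht : t ∈ F.faces) :
    ∑ i, w i • p i ∈ convexHull ℝ (t.map p : Set E) ↔ weightSupport w ⊆ t := by
  classical
  refine ⟨fun h => ?_, fun h => sum_mem_convexHull_map hw.1 hw.2.1 h⟩
  -- The support simplex and t meet in the hull of their common vertices; uniqueness of coordinates
  -- puts the whole support there.
  have hx := T.inter_subset_convexHull (hF _ hw.2.2) (hF _ ht)
    ⟨sum_mem_convexHull_map hw.1 hw.2.1 (Subset.refl _), h⟩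
  rw [← coe_inter, ← map_inter] at hx
  obtain ⟨v, -, v1, vs, vx⟩ := exists_weights_of_mem_convexHull_map hx
  rw [weights_eq_of_sum_eq (hF _ hw.2.2) (Subset.refl _) (vs.trans inter_subset_left)
    (hw.2.1.trans v1.symm) vx.symm]
  exact vs.trans inter_subset_right

/-- The barycentric coordinates identify the realization with the space of the complex. -/
theorem exists_homeomorph_realization {F : PreAbstractSimplicialComplex κ}
    (hF : ∀ s ∈ F.faces, s.map p ∈ T.faces) (hT : ∀ t ∈ T.faces, ∃ s ∈ F.faces, s.map p = t) :
    ∃ e : realization F ≃ₜ T.space, ∀ w, (e w : E) = ∑ i, (w : κ → ℝ) i • p i := by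
  have hmem : ∀ w : realization F, ∑ i, (w : κ → ℝ) i • p i ∈ T.space := fun w =>
    T.convexHull_subset_space (hF _ w.2.2.2)
      (sum_mem_convexHull_map w.2.1 w.2.2.1 (Subset.refl _))
  let f : realization F → T.space := fun w => ⟨_, hmem w⟩
  have hf : Continuous f := by
    refine Continuous.subtype_mk ?_ _
    exact continuous_finsetSum _ fun i _ =>
      ((continuous_apply i).comp continuous_subtype_val).smul continuous_const
  have hinj : Function.Injective f := by
    intro w v hwv
    have hwv' : ∑ i, (w : κ → ℝ) i • p i = ∑ i, (v : κ → ℝ) i • p i := congrArg Subtype.val hwv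
    refine Subtype.ext (weights_eq_of_sum_eq (hF _ v.2.2.2) ?_ (Subset.refl _)
      (w.2.2.1.trans v.2.2.1.symm) hwv')
    refine (sum_mem_convexHull_map_iff hF w.2 v.2.2.2).1 ?_
    rw [hwv']
    exact sum_mem_convexHull_map v.2.1 v.2.2.1 (Subset.refl _)
  have hsurj : Function.Surjective f := by
    rintro ⟨y, hy⟩
    obtain ⟨t, ht, hyt⟩ := Geometry.SimplicialComplex.mem_space_iff.1 hy
    obtain ⟨s, hs, rfl⟩ := hT t ht
    obtain ⟨v, v0, v1, vs, vy⟩ := exists_weights_of_mem_convexHull_map hyt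
    exact ⟨⟨v, v0, v1, PreAbstractSimplicialComplex.mem_of_subset hs vs
      (weightSupport_nonempty v1)⟩, Subtype.ext vy⟩
  have : CompactSpace (realization F) := isCompact_iff_compactSpace.1 (isCompact_realization F)
  exact ⟨Continuous.homeoOfEquivCompactToT2 (f := Equiv.ofBijective f ⟨hinj, hsurj⟩) hf,
    fun w => rfl⟩

/-- The realization of a finite abstract complex of dimension at most one is a finite graph. -/
theorem homotopyEquivFiniteGraph_of_realization {X : Type*} [TopologicalSpace X]
    {G : PreAbstractSimplicialComplex κ} (hG : ∀ s ∈ G.faces, s.card ≤ 2)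
    (h : Nonempty (ContinuousMap.HomotopyEquiv X (realization G))) :
    HomotopyEquivFiniteGraph X := by
  classical
  let b := EuclideanSpace.basisFun (Fin (Fintype.card κ)) ℝ
  -- Vertices go to distinct standard basis vectors, whose affine independence realizes any abstract
  -- complex.
  let p : κ ↪ EuclideanSpace ℝ (Fin (Fintype.card κ)) :=
    ⟨fun i => b (Fintype.equivFin κ i),
      b.toBasis.injective.comp (Fintype.equivFin κ).injective |> fun h => by
        simpa [Function.comp_def] using h⟩
  have hlin : LinearIndependent ℝ (p : κ → EuclideanSpace ℝ (Fin (Fintype.card κ))) :=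
    b.orthonormal.linearIndependent.comp _ (Fintype.equivFin κ).injective
  let Γ : Geometry.SimplicialComplex ℝ (EuclideanSpace ℝ (Fin (Fintype.card κ))) :=
    Geometry.SimplicialComplex.ofAffineIndependent (G.map p) (by
      refine hlin.affineIndependent.range.mono fun x hx => ?_
      simp only [Set.mem_iUnion, Finset.mem_coe] at hx
      obtain ⟨_, ⟨s, _, rfl⟩, hx⟩ := hx
      obtain ⟨i, -, rfl⟩ := mem_image.1 hx
      exact Set.mem_range_self i)
  have hΓ : Γ.faces = (fun s : Finset κ => s.image p) '' G.faces := rfl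
  obtain ⟨e, -⟩ := exists_homeomorph_realization (T := Γ) (p := p) (F := G)
    (fun s hs => by rw [hΓ, map_eq_image]; exact ⟨s, hs, rfl⟩)
    (fun t ht => by
      rw [hΓ] at ht
      obtain ⟨s, hs, rfl⟩ := ht
      exact ⟨s, hs, map_eq_image _ _⟩)
  refine ⟨_, Γ, ?_, ?_, h.map fun a => a.trans e.toHomotopyEquiv⟩
  · rw [hΓ]; exact (Set.toFinite _).image _
  · rw [hΓ]
    rintro _ ⟨s, hs, rfl⟩
    exact card_image_le.trans (hG s hs)

end Realization

/-- Maps whose composites are joined to the identities by segments are homotopy inverse. -/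
theorem nonempty_homotopyEquiv_of_segments {V W : Type*} [AddCommGroup V] [Module ℝ V]
    [TopologicalSpace V] [ContinuousAdd V] [ContinuousSMul ℝ V] [AddCommGroup W] [Module ℝ W]
    [TopologicalSpace W] [ContinuousAdd W] [ContinuousSMul ℝ W] {X : Set V} {Z : Set W}
    (f : C(X, Z)) (g : C(Z, X)) (hgf : ∀ x : X, segment ℝ (g (f x) : V) x ⊆ X)
    (hfg : ∀ z : Z, segment ℝ (f (g z) : W) z ⊆ Z) :
    Nonempty (ContinuousMap.HomotopyEquiv X Z) := by
  refine ⟨⟨f, g, ⟨⟨⟨fun q => ⟨(1 - (q.1 : ℝ)) • (g (f q.2) : V) + (q.1 : ℝ) • (q.2 : V), ?_⟩, ?_⟩,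
    ?_, ?_⟩⟩, ⟨⟨⟨fun q => ⟨(1 - (q.1 : ℝ)) • (f (g q.2) : W) + (q.1 : ℝ) • (q.2 : W), ?_⟩, ?_⟩,
    ?_, ?_⟩⟩⟩⟩
  · exact hgf q.2 ⟨_, _, sub_nonneg.2 q.1.2.2, q.1.2.1, by ring, rfl⟩
  · refine Continuous.subtype_mk ?_ _
    fun_prop
  · intro x
    ext
    simp
  · intro x
    ext
    simp
  · exact hfg q.2 ⟨_, _, sub_nonneg.2 q.1.2.2, q.1.2.1, by ring, rfl⟩
  · refine Continuous.subtype_mk ?_ _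
    fun_prop
  · intro x
    ext
    simp
  · intro x
    ext
    simp

/-! ### The dual graph and its dimension -/

section DualGraph

variable {κ : Type*} [DecidableEq κ]

/-- The dual graph of a complex of dimension `n` relative to a vertex `x`: its vertices are `{x}`
and the faces of dimension at least `n - 1` not containing `x`, and its edges are the incidences,
a face being incident to `x` if it lies in the link of `x`. -/
def dualGraph (F : PreAbstractSimplicialComplex κ) (n : ℕ) (x : κ) :
    PreAbstractSimplicialComplex (Finset κ) where
  faces := {g | g.Nonempty ∧ (∀ a ∈ g, a ∈ F.faces ∧ (a = {x} ∨ (x ∉ a ∧ n ≤ a.card))) ∧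
    (∀ a ∈ g, ∀ b ∈ g, a = {x} ∨ b = {x} ∨ a ⊆ b ∨ b ⊆ a) ∧ g.biUnion id ∈ F.faces}
  isRelLowerSet_faces := by
    rintro g ⟨hne, hv, hc, hu⟩
    refine ⟨hne, fun g' hg' hne' => ⟨hne', fun a ha => hv a (hg' ha),
      fun a ha b hb => hc a (hg' ha) b (hg' hb),
      PreAbstractSimplicialComplex.mem_of_subset hu (biUnion_subset_biUnion_of_subset_left id hg') ?_⟩⟩
    obtain ⟨a, ha⟩ := hne'
    obtain ⟨v, hv⟩ := (F.isRelLowerSet_faces (hv a (hg' ha)).1).1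
    exact ⟨v, mem_biUnion.2 ⟨a, ha, hv⟩⟩

/-- Members other than {x} form a chain of sets with n or n + 1 elements, so there are at most two.
If {x} is present, adjoining x to another member must still give a face; this forces size n and
leaves only one other member. -/
theorem card_le_two_of_mem_dualGraph {F : PreAbstractSimplicialComplex κ} {n : ℕ} {x : κ}
    (hF : ∀ s ∈ F.faces, s.card ≤ n + 1) {g : Finset (Finset κ)}
    (hg : g ∈ (dualGraph F n x).faces) : g.card ≤ 2 := by
  obtain ⟨-, hv, hc, hu⟩ := hg
  have L1 : ∀ a ∈ g, ∀ b ∈ g, a ≠ {x} → b ≠ {x} → a.card = b.card → a = b := by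
    intro a ha b hb hax hbx hab
    rcases hc a ha b hb with h | h | h | h
    · exact absurd h hax
    · exact absurd h hbx
    · exact eq_of_subset_of_card_le h hab.ge
    · exact (eq_of_subset_of_card_le h hab.le).symm
  have L2 : ∀ a ∈ g, a ≠ {x} → n ≤ a.card ∧ a.card ≤ n + 1 := fun a ha hax =>
    ⟨((hv a ha).2.resolve_left hax).2, hF a (hv a ha).1⟩
  have L3 : ∀ a ∈ g, ∀ b ∈ g, a = {x} → b ≠ {x} → b.card = n := by
    intro a ha b hb hax hbx
    have hxb := ((hv b hb).2.resolve_left hbx).1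
    have hsub : insert x b ⊆ g.biUnion id := by
      intro v hvb
      rcases mem_insert.1 hvb with rfl | hvb
      · exact mem_biUnion.2 ⟨a, ha, by simp [hax]⟩
      · exact mem_biUnion.2 ⟨b, hb, hvb⟩
    have h1 := (card_le_card hsub).trans (hF _ hu)
    rw [card_insert_of_notMem hxb] at h1
    have := (L2 b hb hbx).1
    omega
  by_contra! hcard
  obtain ⟨a, ha, b, hb, c, hc', hab, hac, hbc⟩ := two_lt_card.1 hcard
  have aux : ∀ a ∈ g, ∀ b ∈ g, ∀ c ∈ g, a = {x} → b ≠ c → a ≠ b → a ≠ c → False := by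
    intro a ha b hb c hc hax hbc hab hac
    have hbx : b ≠ {x} := fun h => hab (hax.trans h.symm)
    have hcx : c ≠ {x} := fun h => hac (hax.trans h.symm)
    exact hbc (L1 b hb c hc hbx hcx ((L3 a ha b hb hax hbx).trans (L3 a ha c hc hax hcx).symm))
  by_cases hax : a = {x}
  · exact aux a ha b hb c hc' hax hbc hab hac
  by_cases hbx : b = {x}
  · exact aux b hb a ha c hc' hbx hac hab.symm hbc
  by_cases hcx : c = {x}
  · exact aux c hc' a ha b hb hcx hab hac.symm hbc.symm
  have h1 := mt (L1 a ha b hb hax hbx) hab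
  have h2 := mt (L1 a ha c hc' hax hcx) hac
  have h3 := mt (L1 b hb c hc' hbx hcx) hbc
  have := L2 a ha hax
  have := L2 b hb hbx
  have := L2 c hc' hcx
  omega

end DualGraph

/-! ### The homotopy equivalence between the complement and the dual graph -/

section GraphNbhd

variable {κ : Type*} [Fintype κ]

/-- Any positive share of w gives the combination the support of w. Hence straight-line homotopies
preserve sets defined by supports. -/
theorem eq_or_mem_realization_of_mem_segment {F : PreAbstractSimplicialComplex κ} {w w' z : κ → ℝ}
    (hw : w ∈ realization F) (hw' : w' ∈ realization F) (hs : weightSupport w' ⊆ weightSupport w)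
    (hz : z ∈ segment ℝ w' w) :
    z = w' ∨ (z ∈ realization F ∧ weightSupport z = weightSupport w) := by
  obtain ⟨a, b, ha, hb, hab, rfl⟩ := hz
  rcases hb.eq_or_lt with rfl | hb
  · left
    obtain rfl : a = 1 := by simpa using hab
    simp
  · right
    have hsupp : weightSupport (a • w' + b • w) = weightSupport w := by
      ext i
      simp only [mem_weightSupport, Pi.add_apply, Pi.smul_apply, smul_eq_mul]
      have h0 := hw.1 i
      have h0' := hw'.1 i
      constructor
      · intro h hwi
        have hwi' : w' i = 0 := by
          by_contra hn
          exact mem_weightSupport.1 (hs (mem_weightSupport.2 hn)) hwi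
        exact h (by rw [hwi, hwi']; ring)
      · intro h
        have : 0 < w i := lt_of_le_of_ne h0 (Ne.symm h)
        positivity
    refine ⟨⟨fun i => ?_, ?_, hsupp ▸ hw.2.2⟩, hsupp⟩
    · exact add_nonneg (mul_nonneg ha (hw'.1 i)) (mul_nonneg hb.le (hw.1 i))
    · simp only [Pi.add_apply, Pi.smul_apply, smul_eq_mul, sum_add_distrib, ← mul_sum, hw.2.1,
        hw'.2.1, mul_one, hab]

variable [DecidableEq κ]

/-- The complement in the realization of the codimension two skeleton away from `x`. -/
def graphNbhd (F : PreAbstractSimplicialComplex κ) (n : ℕ) (x : κ) : Set (κ → ℝ) :=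
  {w | w ∈ realization F ∧ (x ∈ weightSupport w ∨ n ≤ (weightSupport w).card)}

/-- The weight that a point gives to a vertex of the dual graph, before normalization. -/
noncomputable def nodeWeight (n : ℕ) (x : κ) (a : Finset κ) (w : κ → ℝ) : ℝ :=
  if a = {x} then w x else if x ∉ a ∧ n ≤ a.card then
    (∏ p ∈ a, w p) * ∏ p ∈ a, ∏ q ∈ univ \ insert x a, max 0 (w p - w q) else 0

theorem continuous_nodeWeight (n : ℕ) (x : κ) (a : Finset κ) :
    Continuous (nodeWeight n x a) := by
  unfold nodeWeight
  split_ifs <;> fun_prop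

theorem nodeWeight_nonneg {n : ℕ} {x : κ} {a : Finset κ} {w : κ → ℝ} (hw : ∀ i, 0 ≤ w i) :
    0 ≤ nodeWeight n x a w := by
  unfold nodeWeight
  split_ifs
  · exact hw x
  · exact mul_nonneg (prod_nonneg fun i _ => hw i)
      (prod_nonneg fun p _ => prod_nonneg fun q _ => le_max_left _ _)
  · exact le_rfl

theorem nodeWeight_singleton (n : ℕ) (x : κ) (w : κ → ℝ) : nodeWeight n x {x} w = w x :=
  if_pos rfl

/-- Besides {x}, the sets of nonzero weight are upper level sets of w on the vertices other than x.
Level sets are nested, which is what makes the active nodes span a simplex of the dual graph. -/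
theorem nodeWeight_ne_zero_iff {n : ℕ} {x : κ} {a : Finset κ} {w : κ → ℝ}
    (ha : a ≠ {x}) : nodeWeight n x a w ≠ 0 ↔ (x ∉ a ∧ n ≤ a.card) ∧ (∀ p ∈ a, w p ≠ 0) ∧
      ∀ p ∈ a, ∀ q, q ≠ x → q ∉ a → w q < w p := by
  unfold nodeWeight
  rw [if_neg ha]
  split_ifs with h
  · rw [mul_ne_zero_iff, prod_ne_zero_iff, prod_ne_zero_iff]
    simp only [h, true_and, prod_ne_zero_iff, mem_sdiff, mem_univ, mem_insert, not_or, not_false_iff,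
      and_self]
    refine and_congr_right fun _ => forall₂_congr fun p _ => forall_congr' fun q => ?_
    rw [and_imp]
    refine forall₂_congr fun _ _ => ?_
    rw [← sub_pos (a := w p)]
    constructor
    · intro hne
      by_contra hle
      exact hne (max_eq_left (not_lt.1 hle))
    · intro hlt
      rw [max_eq_right hlt.le]
      exact hlt.ne'
  · simp [h]

/-- Some node is always active: {x} if x is in the support, and otherwise the support itself. -/
theorem sum_nodeWeight_pos {F : PreAbstractSimplicialComplex κ} {n : ℕ} {x : κ} {w : κ → ℝ}
    (hw : w ∈ graphNbhd F n x) : 0 < ∑ a, nodeWeight n x a w := by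
  obtain ⟨⟨h0, h1, hs⟩, hx⟩ := hw
  refine sum_pos' (fun a _ => nodeWeight_nonneg h0) ?_
  by_cases hwx : x ∈ weightSupport w
  · refine ⟨{x}, mem_univ _, ?_⟩
    rw [nodeWeight_singleton]
    exact lt_of_le_of_ne (h0 x) (Ne.symm (mem_weightSupport.1 hwx))
  · refine ⟨weightSupport w, mem_univ _, lt_of_le_of_ne (nodeWeight_nonneg h0) (Ne.symm ?_)⟩
    rw [nodeWeight_ne_zero_iff (fun h => hwx (by rw [h]; exact mem_singleton_self x))]
    refine ⟨⟨hwx, hx.resolve_left hwx⟩, fun p hp => mem_weightSupport.1 hp, fun p hp q _ hq => ?_⟩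
    have hq0 : w q = 0 := by simpa using hq
    rw [hq0]
    exact lt_of_le_of_ne (h0 p) (Ne.symm (mem_weightSupport.1 hp))

/-- The normalized weights that a point gives to the vertices of the dual graph. -/
noncomputable def toDualGraph (n : ℕ) (x : κ) (w : κ → ℝ) (a : Finset κ) : ℝ :=
  nodeWeight n x a w / ∑ b, nodeWeight n x b w

/-- The map placing each vertex of the dual graph at the barycenter of its face. -/
noncomputable def ofDualGraph (c : Finset κ → ℝ) (v : κ) : ℝ :=
  ∑ a, c a * if v ∈ a then (a.card : ℝ)⁻¹ else 0

theorem mem_weightSupport_toDualGraph {F : PreAbstractSimplicialComplex κ} {n : ℕ} {x : κ}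
    {w : κ → ℝ} (hw : w ∈ graphNbhd F n x) {a : Finset κ} :
    a ∈ weightSupport (toDualGraph n x w) ↔ nodeWeight n x a w ≠ 0 := by
  simp [toDualGraph, (sum_nodeWeight_pos hw).ne']

theorem subset_weightSupport_of_nodeWeight {n : ℕ} {x : κ} {w : κ → ℝ} {a : Finset κ}
    (ha : nodeWeight n x a w ≠ 0) : a ⊆ weightSupport w := by
  intro v hv
  rw [mem_weightSupport]
  by_cases hax : a = {x}
  · subst hax
    rw [mem_singleton.1 hv]
    rwa [nodeWeight_singleton] at ha
  · exact ((nodeWeight_ne_zero_iff hax).1 ha).2.1 v hv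

theorem toDualGraph_mem {F : PreAbstractSimplicialComplex κ} {n : ℕ} (hn : 1 ≤ n) {x : κ}
    {w : κ → ℝ} (hw : w ∈ graphNbhd F n x) :
    toDualGraph n x w ∈ realization (dualGraph F n x) := by
  have hpos := sum_nodeWeight_pos hw
  have h0 := hw.1.1
  have h1 : ∑ a, toDualGraph n x w a = 1 := by
    simp only [toDualGraph, ← sum_div]
    exact div_self hpos.ne'
  have hsub : ∀ a ∈ weightSupport (toDualGraph n x w), a ⊆ weightSupport w := fun a ha =>
    subset_weightSupport_of_nodeWeight ((mem_weightSupport_toDualGraph hw).1 ha)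
  have hvert : ∀ a ∈ weightSupport (toDualGraph n x w),
      a ∈ F.faces ∧ (a = {x} ∨ (x ∉ a ∧ n ≤ a.card)) := by
    intro a ha
    have ha' := (mem_weightSupport_toDualGraph hw).1 ha
    by_cases hax : a = {x}
    · exact ⟨PreAbstractSimplicialComplex.mem_of_subset hw.1.2.2 (hsub a ha) (by simp [hax]),
        Or.inl hax⟩
    · have h := ((nodeWeight_ne_zero_iff hax).1 ha').1
      -- Here n ≥ 1 matters: it excludes the empty set as a node.
      exact ⟨PreAbstractSimplicialComplex.mem_of_subset hw.1.2.2 (hsub a ha)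
        (card_pos.1 (by omega)), Or.inr h⟩
  have hne := weightSupport_nonempty h1
  refine ⟨fun a => div_nonneg (nodeWeight_nonneg h0) hpos.le, h1, hne, hvert, ?_, ?_⟩
  · intro a ha b hb
    by_contra! hcon
    obtain ⟨hax, hbx, hab, hba⟩ := hcon
    have ha' := (nodeWeight_ne_zero_iff hax).1 ((mem_weightSupport_toDualGraph hw).1 ha)
    have hb' := (nodeWeight_ne_zero_iff hbx).1 ((mem_weightSupport_toDualGraph hw).1 hb)
    obtain ⟨p, hpa, hpb⟩ := not_subset.1 hab
    obtain ⟨q, hqb, hqa⟩ := not_subset.1 hba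
    exact lt_asymm (ha'.2.2 p hpa q (fun h => hb'.1.1 (h ▸ hqb)) hqa)
      (hb'.2.2 q hqb p (fun h => ha'.1.1 (h ▸ hpa)) hpb)
  · refine PreAbstractSimplicialComplex.mem_of_subset hw.1.2.2 (biUnion_subset.2 hsub) ?_
    obtain ⟨a, ha⟩ := hne
    obtain ⟨v, hv⟩ := (F.isRelLowerSet_faces (hvert a ha).1).1
    exact ⟨v, mem_biUnion.2 ⟨a, ha, hv⟩⟩

theorem weightSupport_ofDualGraph {c : Finset κ → ℝ} (hc : ∀ a, 0 ≤ c a) :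
    weightSupport (ofDualGraph c) = (weightSupport c).biUnion id := by
  ext v
  have hnn : ∀ a ∈ univ, 0 ≤ c a * if v ∈ a then (a.card : ℝ)⁻¹ else 0 := fun a _ =>
    mul_nonneg (hc a) (by split_ifs <;> positivity)
  rw [mem_weightSupport, ofDualGraph, Ne, sum_eq_zero_iff_of_nonneg hnn]
  simp only [mem_univ, true_imp_iff, not_forall, mem_biUnion, mem_weightSupport, id]
  refine exists_congr fun a => ?_
  by_cases hva : v ∈ a
  · have : (a.card : ℝ) ≠ 0 := by exact_mod_cast (card_pos.2 ⟨v, hva⟩).ne'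
    simp [hva, this]
  · simp [hva]

theorem ofDualGraph_mem {F : PreAbstractSimplicialComplex κ} {n : ℕ} {x : κ} {c : Finset κ → ℝ}
    (hc : c ∈ realization (dualGraph F n x)) : ofDualGraph c ∈ graphNbhd F n x := by
  obtain ⟨h0, h1, hne, hvert, -, hu⟩ := hc
  have hsupp := weightSupport_ofDualGraph h0
  refine ⟨⟨fun v => sum_nonneg fun a _ => mul_nonneg (h0 a) (by split_ifs <;> positivity), ?_,
    hsupp ▸ hu⟩, ?_⟩
  · simp only [ofDualGraph]
    rw [sum_comm, ← h1]
    refine sum_congr rfl fun a _ => ?_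
    rw [← mul_sum]
    by_cases ha : c a = 0
    · simp [ha]
    · have hane := (F.isRelLowerSet_faces (hvert a (mem_weightSupport.2 ha)).1).1
      have : (a.card : ℝ) ≠ 0 := by exact_mod_cast (card_pos.2 hane).ne'
      simp [this]
  · rw [hsupp]
    obtain ⟨a, ha⟩ := hne
    have hsub : a ⊆ (weightSupport c).biUnion id := subset_biUnion_of_mem id ha
    rcases (hvert a ha).2 with hax | ⟨-, hcard⟩
    · exact Or.inl (hsub (by simp [hax]))
    · exact Or.inr (hcard.trans (card_le_card hsub))

/-- A simplex of the dual graph has at most one inclusion among its members other than {x}, and the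
level sets, off x, of a combination of their barycenters that have n or more elements are those
members again. -/
theorem weightSupport_toDualGraph_ofDualGraph {F : PreAbstractSimplicialComplex κ} {n : ℕ}
    (hn : 1 ≤ n) {x : κ} (hF : ∀ s ∈ F.faces, s.card ≤ n + 1) {c : Finset κ → ℝ}
    (hc : c ∈ realization (dualGraph F n x)) :
    weightSupport (toDualGraph n x (ofDualGraph c)) ⊆ weightSupport c := by
  intro a ha
  have hmem := ofDualGraph_mem hc
  have ha' := (mem_weightSupport_toDualGraph hmem).1 ha
  have hsub := subset_weightSupport_of_nodeWeight ha'
  obtain ⟨h0, h1, hne, hvert, hchain, hu⟩ := hc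
  rw [weightSupport_ofDualGraph h0] at hsub
  by_cases hax : a = {x}
  · subst hax
    obtain ⟨b, hb, hxb⟩ := mem_biUnion.1 (hsub (mem_singleton_self x))
    rcases (hvert b hb).2 with h | h
    · exact h ▸ hb
    · exact absurd hxb h.1
  obtain ⟨⟨hxa, hna⟩, -, hlt⟩ := (nodeWeight_ne_zero_iff hax).1 ha'
  by_contra hca
  obtain ⟨p, hpa⟩ : a.Nonempty := card_pos.1 (by omega)
  have hpx : p ≠ x := fun h => hxa (h ▸ hpa)
  obtain ⟨b, hb, hpb⟩ := mem_biUnion.1 (hsub hpa)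
  have hbx : b ≠ {x} := fun h => hpx (by simpa [h] using hpb)
  -- the smallest vertex of the edge other than `x`
  obtain ⟨u, hu', humin⟩ := exists_min_image ((weightSupport c).filter (· ≠ {x})) card
    ⟨b, mem_filter.2 ⟨hb, hbx⟩⟩
  obtain ⟨huc, hux⟩ := mem_filter.1 hu'
  have husub : ∀ d ∈ weightSupport c, d ≠ {x} → u ⊆ d := by
    intro d hd hdx
    rcases hchain u huc d hd with h | h | h | h
    · exact absurd h hux
    · exact absurd h hdx
    · exact h
    · exact (eq_of_subset_of_card_le h (humin d (mem_filter.2 ⟨hd, hdx⟩))).ge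
  have hxu : x ∉ u := ((hvert u huc).2.resolve_left hux).1
  have hua : u ⊆ a := by
    intro v hvu
    by_contra hva
    have hvx : v ≠ x := fun h => hxu (h ▸ hvu)
    -- Every active node except {x} contains u and hence v, so term by term v carries at least the
    -- weight of p.
    refine absurd (hlt p hpa v hvx hva) (not_lt.2 ?_)
    refine sum_le_sum fun d _ => ?_
    by_cases hd : c d = 0
    · simp [hd]
    refine mul_le_mul_of_nonneg_left ?_ (h0 d)
    by_cases hdx : d = {x}
    · simp [hdx, hpx, hvx]
    · rw [if_pos (husub d (mem_weightSupport.2 hd) hdx hvu)]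
      split_ifs
      · exact le_rfl
      · positivity
  -- As a properly contains u, it has n + 1 elements and exhausts the union of the active nodes. An
  -- active node d reaching outside u also has n + 1 elements, so d = a.
  have hune : u ≠ a := fun h => hca (h ▸ huc)
  have hlt' := card_lt_card (hua.ssubset_of_ne hune)
  have hun := ((hvert u huc).2.resolve_left hux).2
  have hcardU := hF _ hu
  have haU : a = (weightSupport c).biUnion id := eq_of_subset_of_card_le hsub (by omega)
  obtain ⟨q, hqa, hqu⟩ := not_subset.1 (fun h => hune (hua.antisymm h))
  obtain ⟨d, hd, hqd⟩ := mem_biUnion.1 (hsub hqa)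
  have hdx : d ≠ {x} := fun h => hxa (by
    have hq : q = x := by simpa [h] using hqd
    exact hq ▸ hqa)
  have hda : d ⊆ a := haU ▸ subset_biUnion_of_mem id hd
  have hud := card_lt_card
    ((husub d hd hdx).ssubset_of_ne (fun h => hqu (h ▸ hqd)))
  have hacard : a.card ≤ n + 1 := haU ▸ hcardU
  exact hca (eq_of_subset_of_card_le hda (by omega) ▸ hd)

theorem nonempty_homotopyEquiv_dualGraph {F : PreAbstractSimplicialComplex κ} {n : ℕ} (hn : 1 ≤ n)
    {x : κ} (hF : ∀ s ∈ F.faces, s.card ≤ n + 1) :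
    Nonempty (ContinuousMap.HomotopyEquiv (graphNbhd F n x) (realization (dualGraph F n x))) := by
  let f : C(graphNbhd F n x, realization (dualGraph F n x)) :=
    ⟨fun w => ⟨toDualGraph n x w, toDualGraph_mem hn w.2⟩, by
      refine Continuous.subtype_mk (continuous_pi fun a => ?_) _
      refine Continuous.div ((continuous_nodeWeight n x a).comp continuous_subtype_val) ?_
        fun w => (sum_nodeWeight_pos w.2).ne'
      exact continuous_finsetSum _ fun b _ =>
        (continuous_nodeWeight n x b).comp continuous_subtype_val⟩
  let g : C(realization (dualGraph F n x), graphNbhd F n x) :=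
    ⟨fun c => ⟨ofDualGraph c, ofDualGraph_mem c.2⟩, by
      refine Continuous.subtype_mk (continuous_pi fun v => ?_) _
      exact continuous_finsetSum _ fun a _ =>
        ((continuous_apply a).comp continuous_subtype_val).mul continuous_const⟩
  refine nonempty_homotopyEquiv_of_segments f g (fun w z hz => ?_) (fun c z hz => ?_)
  · have hsub : weightSupport (g (f w) : κ → ℝ) ⊆ weightSupport (w : κ → ℝ) := by
      refine (weightSupport_ofDualGraph (f w).2.1).trans_subset (biUnion_subset.2 fun a ha => ?_)
      exact subset_weightSupport_of_nodeWeight ((mem_weightSupport_toDualGraph w.2).1 ha)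
    rcases eq_or_mem_realization_of_mem_segment w.2.1 (g (f w)).2.1 hsub hz with rfl | ⟨h1, h2⟩
    · exact (g (f w)).2
    · exact ⟨h1, h2 ▸ w.2.2⟩
  · rcases eq_or_mem_realization_of_mem_segment c.2 (f (g c)).2
      (weightSupport_toDualGraph_ofDualGraph hn hF c.2) hz with rfl | h
    · exact (f (g c)).2
    · exact h.1

end GraphNbhd

/-! ### Invariance of dimension for simplices -/

section Dimension

variable {E : Type*} [NormedAddCommGroup E] [NormedSpace ℝ E]

theorem AffineIndependent.card_le_of_subset_convexHull {s t : Finset E}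
    (hs : AffineIndependent ℝ ((↑) : s → E)) (hst : (s : Set E) ⊆ convexHull ℝ (t : Set E)) :
    s.card ≤ t.card :=
  hs.card_le_card_of_subset_affineSpan (hst.trans (convexHull_subset_affineSpan _))

/-- Finitely many simplices with at most `n` vertices do not cover a simplex with `n + 1`
vertices. -/
theorem exists_card_le_of_convexHull_subset {t : Finset E}
    (ht : AffineIndependent ℝ ((↑) : t → E)) {S : Set (Finset E)} (hS : S.Finite)
    (hcover : convexHull ℝ (t : Set E) ⊆ ⋃ s ∈ S, convexHull ℝ (s : Set E)) (hne : t.Nonempty) :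
    ∃ s ∈ S, t.card ≤ s.card := by
  classical
  by_contra! hcard
  -- Placing points at height 1 turns affine independence into linear independence. Each smaller
  -- simplex then yields a proper subspace of the weight space, of measure zero, and finitely many
  -- cannot cover the open positive orthant.
  let lift : E → ℝ × E := fun p => (1, p)
  let L : (t → ℝ) →ₗ[ℝ] ℝ × E := Fintype.linearCombination ℝ (fun p : t => lift p)
  have hLapp : ∀ w, L w = (∑ p, w p, ∑ p, w p • (p : E)) := by
    intro w
    rw [Fintype.linearCombination_apply]
    ext
    · simp [lift, Prod.fst_sum]
    · simp [lift, Prod.snd_sum]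
  have hLinj : LinearMap.ker L = ⊥ := by
    rw [LinearMap.ker_eq_bot']
    intro w hw
    rw [hLapp, Prod.mk_eq_zero] at hw
    funext p
    exact affineIndependent_iff.1 ht univ w hw.1 hw.2 p (mem_univ p)
  let M : Finset E → Submodule ℝ (t → ℝ) := fun s =>
    (Submodule.span ℝ ((s.image lift : Finset (ℝ × E)) : Set (ℝ × E))).comap L
  have hM : ∀ s ∈ S, M s ≠ ⊤ := by
    intro s hs htop
    have hle : LinearMap.range L ≤ Submodule.span ℝ ((s.image lift : Finset (ℝ × E)) : Set _) := by
      rw [LinearMap.range_eq_map]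
      exact Submodule.map_le_iff_le_comap.2 htop.ge
    have h1 := Submodule.finrank_mono hle
    rw [LinearMap.finrank_range_of_inj (LinearMap.ker_eq_bot.1 hLinj)] at h1
    have h2 := finrank_span_finset_le_card (R := ℝ) (s.image lift)
    have h3 : (s.image lift).card ≤ s.card := card_image_le
    have h4 : Module.finrank ℝ (t → ℝ) = t.card := by simp
    have h5 := hcard s hs
    unfold Set.finrank at h2
    omega
  have hzero : MeasureTheory.volume (⋃ s ∈ S, (M s : Set (t → ℝ))) = 0 :=
    (MeasureTheory.measure_biUnion_null_iff hS.countable).2 fun s hs =>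
      MeasureTheory.Measure.addHaar_submodule _ _ (hM s hs)
  have hopen : IsOpen {w : t → ℝ | ∀ i, 0 < w i} := by
    have : {w : t → ℝ | ∀ i, 0 < w i} = ⋂ i, {w | 0 < w i} := by ext; simp
    rw [this]
    exact isOpen_iInter_of_finite fun i => isOpen_lt continuous_const (continuous_apply i)
  have hpos := hopen.measure_pos MeasureTheory.volume ⟨fun _ => 1, fun _ => one_pos⟩
  refine hpos.ne' (MeasureTheory.measure_mono_null (fun w hw => ?_) hzero)
  have : Nonempty t := hne.to_subtype
  have hsum : 0 < ∑ p, w p := sum_pos (fun p _ => hw p) univ_nonempty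
  have hx : ∑ p, (w p / ∑ q, w q) • (p : E) ∈ convexHull ℝ (t : Set E) :=
    (convex_convexHull ℝ _).sum_mem (fun p _ => (div_pos (hw p) hsum).le)
      (by rw [← sum_div, div_self hsum.ne']) fun p _ => subset_convexHull ℝ _ p.2
  obtain ⟨s, hs, hxs⟩ := Set.mem_iUnion₂.1 (hcover hx)
  refine Set.mem_biUnion hs ?_
  obtain ⟨a, -, a1, ax⟩ := Finset.mem_convexHull'.1 hxs
  change L w ∈ Submodule.span ℝ _
  have hlift : L w = (∑ q, w q) • ∑ y ∈ s, a y • lift y := by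
    rw [hLapp]
    ext
    · simp [lift, Prod.fst_sum, a1]
    · have : (∑ y ∈ s, a y • lift y).2 = ∑ p, (w p / ∑ q, w q) • (p : E) := by
        simp [lift, Prod.snd_sum, ax]
      rw [Prod.smul_snd, this, smul_sum]
      exact sum_congr rfl fun p _ => by rw [smul_smul, mul_div_cancel₀ _ hsum.ne']
  rw [hlift]
  refine Submodule.smul_mem _ _ (Submodule.sum_mem _ fun y hy => Submodule.smul_mem _ _ ?_)
  exact Submodule.subset_span (mem_coe.2 (mem_image_of_mem lift hy))

end Dimension

theorem nonempty_homeomorph_of_mem_iff {V W : Type*} [TopologicalSpace V] [TopologicalSpace W]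
    {A X : Set V} {Z U : Set W} (e : A ≃ₜ Z) (hX : X ⊆ A) (hU : U ⊆ Z)
    (h : ∀ a : A, (a : V) ∈ X ↔ (e a : W) ∈ U) : Nonempty (X ≃ₜ U) := by
  refine ⟨⟨⟨fun a => ⟨e ⟨a, hX a.2⟩, (h _).1 a.2⟩, fun u => ⟨e.symm ⟨u, hU u.2⟩, (h _).2 ?_⟩,
    fun a => ?_, fun u => ?_⟩, ?_, ?_⟩⟩
  · rw [e.apply_symm_apply]
    exact u.2
  · ext
    simp
  · ext
    simp
  · refine Continuous.subtype_mk (continuous_subtype_val.comp (e.continuous.comp ?_)) _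
    exact continuous_subtype_val.subtype_mk _
  · refine Continuous.subtype_mk (continuous_subtype_val.comp (e.symm.continuous.comp ?_)) _
    exact continuous_subtype_val.subtype_mk _

/-! ### The codimension two skeleton away from a vertex -/

section Skeleton

variable {E : Type*} [NormedAddCommGroup E] [NormedSpace ℝ E]

namespace Geometry.SimplicialComplex

/-- The part of the codimension two skeleton of `T` (with respect to the dimension `n`) made up of
the simplices that do not contain `x`. -/
def skeletonAway (T : SimplicialComplex ℝ E) (n : ℕ) (x : E) : Set E :=
  ⋃ s ∈ {s | s ∈ T.faces ∧ s.card + 2 ≤ n + 1 ∧ x ∉ s}, convexHull ℝ (s : Set E)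

/-- The simplices of the codimension two skeleton away from `x` that do not lie in `B`, together
with their faces. -/
def skeletonAwayDiff (T : SimplicialComplex ℝ E) (n : ℕ) (x : E) (B : Set E) :
    SimplicialComplex ℝ E where
  faces := {s | s ∈ T.faces ∧
    ∃ t ∈ T.faces, s ⊆ t ∧ t.card + 2 ≤ n + 1 ∧ x ∉ t ∧ ∃ z ∈ t, z ∉ B}
  isRelLowerSet_faces := by
    rintro s ⟨hs, t, ht, hst, h⟩
    exact ⟨T.nonempty_of_mem_faces hs, fun r hrs hr =>
      ⟨T.down_closed hs hrs hr, t, ht, Finset.Subset.trans hrs hst, h⟩⟩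
  indep := fun hs => T.indep hs.1
  inter_subset_convexHull := fun hs ht => T.inter_subset_convexHull hs.1 ht.1

/-- The subset `B` of the space of `T` is a full subcomplex. -/
def IsFullSubcomplex (T : SimplicialComplex ℝ E) (B : Set E) : Prop :=
  (∀ s ∈ T.faces, ∀ w : E → ℝ, (∀ q ∈ s, 0 < w q) → ∑ q ∈ s, w q = 1 →
    ∑ q ∈ s, w q • q ∈ B → (s : Set E) ⊆ B) ∧
  ∀ s ∈ T.faces, (s : Set E) ⊆ B → convexHull ℝ (s : Set E) ⊆ B

variable {T : SimplicialComplex ℝ E} {B : Set E}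

/-- The point is interior to the face spanned by the vertices of nonzero weight, and fullness
applies to that face. -/
theorem IsFullSubcomplex.mem_of_weight (hB : T.IsFullSubcomplex B) {t : Finset E}
    (ht : t ∈ T.faces) {w : E → ℝ} (w0 : ∀ q ∈ t, 0 ≤ w q) (w1 : ∑ q ∈ t, w q = 1)
    (hw : ∑ q ∈ t, w q • q ∈ B) {q : E} (hq : q ∈ t) (hwq : w q ≠ 0) : q ∈ B := by
  classical
  have hsub := filter_subset (w · ≠ 0) t
  refine hB.1 (t.filter (w · ≠ 0)) (T.down_closed ht hsub ⟨q, mem_filter.2 ⟨hq, hwq⟩⟩) w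
    (fun r hr => ?_) ?_ ?_ (mem_coe.2 (mem_filter.2 ⟨hq, hwq⟩))
  · rw [mem_filter] at hr
    exact lt_of_le_of_ne (w0 r hr.1) (Ne.symm hr.2)
  · rw [← w1]
    refine sum_subset hsub fun r hr hn => ?_
    by_contra h0
    exact hn (mem_filter.2 ⟨hr, h0⟩)
  · convert hw using 1
    refine sum_subset hsub fun r hr hn => ?_
    have : w r = 0 := by
      by_contra h0
      exact hn (mem_filter.2 ⟨hr, h0⟩)
    rw [this, zero_smul]

theorem skeletonAway_subset_space (T : SimplicialComplex ℝ E) (n : ℕ) (x : E) :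
    T.skeletonAway n x ⊆ T.space :=
  Set.iUnion₂_subset fun _ hs => T.convexHull_subset_space hs.1

theorem isClosed_skeletonAway (hT : T.faces.Finite) (n : ℕ) (x : E) :
    IsClosed (T.skeletonAway n x) :=
  ((hT.subset fun _ hs => hs.1).isCompact_biUnion fun s _ =>
    s.finite_toSet.isCompact_convexHull ℝ).isClosed

/-- A point of B is interior to a face with all vertices in B; that face is of codimension at least
two and omits x. -/
theorem subset_skeletonAway (hB : T.IsFullSubcomplex B) (hBT : B ⊆ T.space) {n : ℕ}
    (hdim : ∀ s ∈ T.faces, (s : Set E) ⊆ B → s.card + 2 ≤ n + 1) {x : E} (hx : x ∉ B) :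
    B ⊆ T.skeletonAway n x := by
  classical
  intro y hy
  obtain ⟨t, ht, hyt⟩ := mem_space_iff.1 (hBT hy)
  obtain ⟨w, w0, ws, w1, rfl⟩ := exists_weights_of_mem_convexHull (Subset.refl t) hyt
  have hmem : ∀ q ∈ t.filter (w · ≠ 0), q ∈ B := fun q hq =>
    hB.mem_of_weight ht (fun q _ => w0 q) w1 hy (mem_filter.1 hq).1 (mem_filter.1 hq).2
  have e1 : ∑ q ∈ t.filter (w · ≠ 0), w q = 1 := by
    rw [sum_filter_ne_zero, w1]
  have hne : (t.filter (w · ≠ 0)).Nonempty := by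
    by_contra hn
    rw [not_nonempty_iff_eq_empty.1 hn, sum_empty] at e1
    exact zero_ne_one e1
  have hface := T.down_closed ht (filter_subset (w · ≠ 0) t) hne
  refine Set.mem_biUnion ⟨hface, hdim _ hface hmem, fun hxs => hx (hmem x hxs)⟩ ?_
  refine Finset.mem_convexHull'.2 ⟨w, fun q _ => w0 q, e1, ?_⟩
  refine sum_subset (filter_subset _ _) fun q hq hn => ?_
  have : w q = 0 := by
    by_contra h0
    exact hn (mem_filter.2 ⟨hq, h0⟩)
  rw [this, zero_smul]

/-- If a simplex has a vertex z off B, moving any of its points toward z gives z positive weight and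
so leaves B, by fullness. Conversely, a simplex with all vertices in B lies in B. -/
theorem closure_skeletonAway_diff (hB : T.IsFullSubcomplex B) (hT : T.faces.Finite) (n : ℕ)
    (x : E) : closure (T.skeletonAway n x \ B) = (T.skeletonAwayDiff n x B).space := by
  classical
  apply Set.Subset.antisymm
  · refine closure_minimal ?_ (isCompact_space (K := T.skeletonAwayDiff n x B)
      (hT.subset fun _ hs => hs.1)).isClosed
    rintro y ⟨hy, hyB⟩
    obtain ⟨s, ⟨hs, hcard, hxs⟩, hys⟩ := Set.mem_iUnion₂.1 hy
    have hz : ∃ z ∈ s, z ∉ B := by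
      by_contra! hz
      exact hyB (hB.2 s hs hz hys)
    exact mem_space_iff.2 ⟨s, ⟨hs, s, hs, Subset.refl s, hcard, hxs, hz⟩, hys⟩
  · intro y hy
    obtain ⟨s, ⟨-, t, ht, hst, hcard, hxt, z, hzt, hzB⟩, hys⟩ := mem_space_iff.1 hy
    have hyt : y ∈ convexHull ℝ (t : Set E) := convexHull_mono (mod_cast hst) hys
    have hlim : Filter.Tendsto (AffineMap.lineMap y z : ℝ → E) (nhdsWithin 0 (Set.Ioi 0))
        (nhds y) := by
      have hcont : Continuous (AffineMap.lineMap y z : ℝ → E) := AffineMap.lineMap_continuous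
      have := hcont.tendsto 0
      rw [AffineMap.lineMap_apply_zero] at this
      exact this.mono_left nhdsWithin_le_nhds
    refine mem_closure_of_tendsto hlim ?_
    filter_upwards [Ioo_mem_nhdsGT (zero_lt_one' ℝ)] with r hr
    obtain ⟨w, w0, ws, w1, rfl⟩ := exists_weights_of_mem_convexHull (Subset.refl t) hyt
    have hline : AffineMap.lineMap (∑ q ∈ t, w q • q) z r =
        ∑ q ∈ t, ((1 - r) * w q + if q = z then r else 0) • q := by
      simp only [add_smul, sum_add_distrib, mul_smul, ← smul_sum, ite_smul, zero_smul,
        sum_ite_eq', if_pos hzt, AffineMap.lineMap_apply_module]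
    have hr1 : 0 < 1 - r := sub_pos.2 hr.2
    have v0 : ∀ q ∈ t, 0 ≤ (1 - r) * w q + if q = z then r else 0 := fun q _ =>
      add_nonneg (mul_nonneg hr1.le (w0 q)) (by split_ifs <;> linarith [hr.1])
    have v1 : ∑ q ∈ t, ((1 - r) * w q + if q = z then r else 0) = 1 := by
      simp [sum_add_distrib, ← mul_sum, w1, hzt]
    refine ⟨Set.mem_biUnion ⟨ht, hcard, hxt⟩ ?_, fun hmem => hzB ?_⟩
    · rw [hline]
      exact Finset.mem_convexHull'.2 ⟨_, v0, v1, rfl⟩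
    · rw [hline] at hmem
      refine hB.mem_of_weight ht v0 v1 hmem hzt ?_
      rw [if_pos rfl]
      have := mul_nonneg hr1.le (w0 z)
      linarith [hr.1]

/-- If `T` has an `n`-simplex then the codimension two skeleton away from `x ∉ B` has an
`(n - 2)`-simplex not contained in `B`. -/
theorem exists_mem_skeletonAwayDiff {n : ℕ} (hn : 2 ≤ n)
    (hdim : ∀ s ∈ T.faces, (s : Set E) ⊆ B → s.card + 2 ≤ n + 1) {t : Finset E} (ht : t ∈ T.faces)
    (htcard : n + 1 ≤ t.card) (x : E) :
    ∃ s ∈ (T.skeletonAwayDiff n x B).faces, s.card + 2 = n + 1 := by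
  classical
  have hcard : n ≤ (t.erase x).card := by
    have := pred_card_le_card_erase (s := t) (a := x)
    omega
  obtain ⟨z, hz, hzB⟩ : ∃ z ∈ t.erase x, z ∉ B := by
    by_contra! hall
    have hface := T.down_closed ht (erase_subset x t) (card_pos.1 (by omega))
    have := hdim _ hface hall
    omega
  -- An (n - 2)-simplex has n - 1 vertices; z is kept among them so that the simplex is not inside
  -- B.
  obtain ⟨s, hzs, hst, hs⟩ := exists_subsuperset_card_eq (n := n - 1)
    (singleton_subset_iff.2 hz) (by rw [card_singleton]; omega) (by omega)
  have hzs' := singleton_subset_iff.1 hzs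
  have hface := T.down_closed ht (hst.trans (erase_subset x t)) ⟨z, hzs'⟩
  exact ⟨s, ⟨hface, s, hface, Subset.refl s, by omega, fun hx => by simpa using hst hx,
    z, hzs', hzB⟩, by omega⟩

/-- The complement of the codimension two skeleton away from a vertex is a finite graph up to
homotopy, and the complements for the vertices outside a full subcomplex cover its complement. -/
theorem homotopyEquivFiniteGraph_and_iUnion_compl_skeletonAway (hT : T.faces.Finite)
    (hB : T.IsFullSubcomplex B) {n : ℕ} (hn : 1 ≤ n) (hdim : ∀ s ∈ T.faces, s.card ≤ n + 1) :
    (∀ x ∈ T.vertices, HomotopyEquivFiniteGraph (T.space \ T.skeletonAway n x : Set E)) ∧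
      ∀ y ∈ T.space \ B, ∃ x ∈ T.vertices, x ∉ B ∧ y ∉ T.skeletonAway n x := by
  classical
  have hvfin : T.vertices.Finite := by
    rw [vertices_eq]
    exact hT.biUnion fun s _ => s.finite_toSet
  have : Fintype T.vertices := hvfin.fintype
  let p : T.vertices ↪ E := Function.Embedding.subtype _
  let F : PreAbstractSimplicialComplex T.vertices :=
    { faces := {s | s.map p ∈ T.faces}
      isRelLowerSet_faces := fun s hs => ⟨by simpa using T.nonempty_of_mem_faces hs,
        fun r hr hne => T.down_closed hs (map_subset_map.2 hr) (by simpa using hne)⟩ }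
  have hF : ∀ s ∈ F.faces, s.map p ∈ T.faces := fun s hs => hs
  have hF' : ∀ t ∈ T.faces, ∃ s ∈ F.faces, s.map p = t := by
    intro t ht
    have hmap : (t.subtype (· ∈ T.vertices)).map p = t :=
      subtype_map_of_mem fun q hq => by
        rw [vertices_eq]
        exact Set.mem_biUnion ht hq
    exact ⟨_, show _ ∈ T.faces by rwa [hmap], hmap⟩
  obtain ⟨e, he⟩ := exists_homeomorph_realization hF hF'
  have hFcard : ∀ s ∈ F.faces, s.card ≤ n + 1 := fun s hs => by
    simpa using hdim _ (hF s hs)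
  have key : ∀ (x : T.vertices) (w : realization F),
      (e w : E) ∈ T.skeletonAway n x ↔ (w : T.vertices → ℝ) ∉ graphNbhd F n x := by
    intro x w
    have hg : (w : T.vertices → ℝ) ∉ graphNbhd F n x ↔
        x ∉ weightSupport (w : T.vertices → ℝ) ∧
          (weightSupport (w : T.vertices → ℝ)).card + 2 ≤ n + 1 := by
      rw [graphNbhd, Set.mem_ofPred_eq, not_and_or, not_or, not_le]
      constructor
      · rintro (h | h)
        · exact absurd w.2 h
        · exact ⟨h.1, by omega⟩
      · exact fun h => Or.inr ⟨h.1, by omega⟩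
    rw [hg, skeletonAway, Set.mem_iUnion₂]
    constructor
    · rintro ⟨t, ⟨ht, hcard, hxt⟩, hmem⟩
      obtain ⟨s, hs, rfl⟩ := hF' t ht
      rw [he, sum_mem_convexHull_map_iff hF w.2 hs] at hmem
      rw [card_map] at hcard
      exact ⟨fun hx => hxt (mem_map_of_mem p (hmem hx)), by
        have := card_le_card hmem
        omega⟩
    · rintro ⟨hx, hcard⟩
      refine ⟨(weightSupport (w : T.vertices → ℝ)).map p, ⟨hF _ w.2.2.2, by rwa [card_map],
        fun h => hx ?_⟩, ?_⟩
      · obtain ⟨x', hx', hxx⟩ := mem_map.1 h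
        rwa [← Subtype.ext (a1 := x') (a2 := x) hxx]
      · rw [he, sum_mem_convexHull_map_iff hF w.2 w.2.2.2]
  refine ⟨fun x hx => ?_, fun y hy => ?_⟩
  · obtain ⟨e'⟩ := nonempty_homeomorph_of_mem_iff e (X := graphNbhd F n ⟨x, hx⟩)
      (U := T.space \ T.skeletonAway n x) (fun w hw => hw.1) Set.sdiff_subset (fun w => by
        have := key ⟨x, hx⟩ w
        rw [Set.mem_sdiff, and_iff_right (e w).2, this, not_not])
    exact homotopyEquivFiniteGraph_of_realization
      (fun s hs => card_le_two_of_mem_dualGraph hFcard hs)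
      ((nonempty_homotopyEquiv_dualGraph hn hFcard).map fun a =>
        e'.symm.toHomotopyEquiv.trans a)
  · set w := e.symm ⟨y, hy.1⟩ with hw
    have hew : (e w : E) = y := by rw [hw, e.apply_symm_apply]
    -- If all vertices of the simplex with y in its interior lay in B, fullness would put y in B.
    obtain ⟨x, hxw, hxB⟩ : ∃ x ∈ weightSupport (w : T.vertices → ℝ), (x : E) ∉ B := by
      by_contra! hall
      refine hy.2 (hB.2 _ (hF _ w.2.2.2) (fun q hq => ?_)
        (hew ▸ he w ▸ sum_mem_convexHull_map w.2.1 w.2.2.1 (Subset.refl _)))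
      obtain ⟨x, hx, rfl⟩ := mem_map.1 (mem_coe.1 hq)
      exact hall x hx
    refine ⟨x, x.2, hxB, ?_⟩
    rw [← hew, key, not_not]
    exact ⟨w.2, Or.inl hxw⟩

end Geometry.SimplicialComplex

end Skeleton

/-! ### The main theorem -/

theorem mainTheorem7 {N : ℕ} (n : ℕ) (Y B : Set (EuclideanSpace ℝ (Fin N)))
    (hY : IsPLPseudomanifold n Y) (hB : IsSubpolyhedronOfCodimGE 2 n B Y) :
    ∃ (m : ℕ) (V : Fin m → Set (EuclideanSpace ℝ (Fin N))),
      (⋃ i, V i) = Y \ B ∧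
      ∀ i,
        (∃ O : Set (EuclideanSpace ℝ (Fin N)), IsOpen O ∧ V i = (Y \ B) ∩ O) ∧
        IsSubpolyhedronOfCodim 2 n (closure ((Y \ B) \ V i)) Y ∧
        HomotopyEquivFiniteGraph (V i) := by
  classical
  obtain ⟨K, ⟨hK, rfl⟩, hpure, -⟩ := hY
  obtain ⟨hBY, L, ⟨hL, rfl⟩, hLdim⟩ := hB
  have hKcard : ∀ s ∈ K.faces, s.card ≤ n + 1 := fun s hs => by
    obtain ⟨t, -, hst, ht⟩ := hpure s hs
    exact ht ▸ card_le_card hst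
  -- For n ≤ 1 the codimension bound forces B to be empty, and the single set V = Y works: Y is
  -- itself a finite graph.
  rcases le_or_gt n 1 with hn | hn
  · have hLempty : L.space = ∅ := by
      refine Set.eq_empty_of_forall_notMem fun y hy => ?_
      obtain ⟨s, hs, -⟩ := Geometry.SimplicialComplex.mem_space_iff.1 hy
      have := card_pos.2 (L.nonempty_of_mem_faces hs)
      have := hLdim s hs
      omega
    refine ⟨1, fun _ => K.space, by simp [hLempty, Set.iUnion_const], fun _ => ⟨⟨Set.univ, isOpen_univ, ?_⟩, ?_, ?_⟩⟩
    · simp [hLempty]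
    · rw [hLempty, Set.sdiff_empty, Set.sdiff_self, closure_empty]
      exact ⟨Set.empty_subset _, ⊥, ⟨Set.finite_empty, Geometry.SimplicialComplex.space_bot⟩,
        fun s hs => absurd hs (Set.notMem_empty s), fun h => by omega⟩
    · exact ⟨N, K, hK, fun s hs => (hKcard s hs).trans (by omega),
        ⟨ContinuousMap.HomotopyEquiv.refl _⟩⟩
  obtain ⟨T, hT, hTK, hTsub, hTfull, hThull⟩ := exists_triangulation_full K L hK hL
  have hfull : T.IsFullSubcomplex L.space := by
    refine ⟨fun s hs w w0 w1 hw => ?_, hThull⟩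
    obtain ⟨t, ht, hst⟩ := hTfull s hs w w0 w1 hw
    exact hst.trans (L.convexHull_subset_space ht)
  have hTcard : ∀ s ∈ T.faces, s.card ≤ n + 1 := fun s hs => by
    obtain ⟨t, ht, hst⟩ := hTsub s hs
    exact ((T.indep hs).card_le_of_subset_convexHull hst).trans (hKcard t ht)
  have hLT : ∀ s ∈ T.faces, (s : Set _) ⊆ L.space → s.card + 2 ≤ n + 1 := by
    intro s hs hsL
    -- The barycenter of s is an interior point lying in B, so s is contained in a single simplex of
    -- L, which bounds its dimension.
    have hpos : (0 : ℝ) < s.card := by exact_mod_cast card_pos.2 (T.nonempty_of_mem_faces hs)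
    have w1 : ∑ _q ∈ s, (s.card : ℝ)⁻¹ = 1 := by
      rw [sum_const, nsmul_eq_mul, mul_inv_cancel₀ hpos.ne']
    obtain ⟨t, ht, hst⟩ := hTfull s hs (fun _ => (s.card : ℝ)⁻¹) (fun _ _ => inv_pos.2 hpos) w1
      (hThull s hs hsL (Finset.mem_convexHull'.2 ⟨_, fun _ _ => (inv_pos.2 hpos).le, w1, rfl⟩))
    have := (T.indep hs).card_le_of_subset_convexHull hst
    have := hLdim t ht
    omega
  have hbig : T.space.Nonempty → ∃ t ∈ T.faces, n + 1 ≤ t.card := by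
    rintro ⟨y, hy⟩
    rw [hTK] at hy
    obtain ⟨s, hs, -⟩ := Geometry.SimplicialComplex.mem_space_iff.1 hy
    obtain ⟨t, ht, -, htcard⟩ := hpure s hs
    rw [← htcard]
    -- The finitely many simplices of T cover an n-simplex of K, so they cannot all have smaller
    -- dimension.
    refine exists_card_le_of_convexHull_subset (K.indep ht) hT ?_ (K.nonempty_of_mem_faces ht)
    exact (K.convexHull_subset_space ht).trans hTK.ge
  obtain ⟨hgraph, hcover⟩ :=
    Geometry.SimplicialComplex.homotopyEquivFiniteGraph_and_iUnion_compl_skeletonAway hT hfull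
      (n := n) (by omega) hTcard
  rw [← hTK] at hBY ⊢
  have hvfin : (T.vertices \ L.space).Finite := by
    refine Set.Finite.subset ?_ Set.sdiff_subset
    rw [Geometry.SimplicialComplex.vertices_eq]
    exact hT.biUnion fun s _ => s.finite_toSet
  have hsub : ∀ x ∉ L.space, L.space ⊆ T.skeletonAway n x := fun x hx =>
    Geometry.SimplicialComplex.subset_skeletonAway hfull hBY hLT hx
  obtain ⟨m, f, -, hf⟩ := hvfin.fin_param
  have hfmem : ∀ i, f i ∈ T.vertices \ L.space := fun i => hf ▸ Set.mem_range_self i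
  refine ⟨m, fun i => T.space \ T.skeletonAway n (f i), ?_, fun i => ⟨?_, ?_, ?_⟩⟩
  · refine Set.Subset.antisymm (Set.iUnion_subset fun i => ?_) fun y hy => ?_
    · exact Set.sdiff_subset_sdiff_right (hsub _ (hfmem i).2)
    · obtain ⟨x, hx, hxL, hyx⟩ := hcover y hy
      obtain ⟨i, rfl⟩ : x ∈ Set.range f := hf ▸ ⟨hx, hxL⟩
      exact Set.mem_iUnion.2 ⟨i, hy.1, hyx⟩
  · refine ⟨(T.skeletonAway n (f i))ᶜ,
      (Geometry.SimplicialComplex.isClosed_skeletonAway hT n _).isOpen_compl, ?_⟩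
    ext y
    have := @hsub _ (hfmem i).2 y
    simp only [Set.mem_sdiff, Set.mem_inter_iff, Set.mem_compl_iff]
    tauto
  · have heq : (T.space \ L.space) \ (T.space \ T.skeletonAway n (f i)) =
        T.skeletonAway n (f i) \ L.space := by
      ext y
      have := @Geometry.SimplicialComplex.skeletonAway_subset_space _ _ _ T n (f i) y
      simp only [Set.mem_sdiff]
      tauto
    rw [heq, Geometry.SimplicialComplex.closure_skeletonAway_diff hfull hT]
    refine ⟨?_, T.skeletonAwayDiff n (f i) L.space, ⟨hT.subset fun _ hs => hs.1, rfl⟩, ?_,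
      fun _ => ?_⟩
    · exact Set.iUnion₂_subset fun s hs => T.convexHull_subset_space hs.1
    · rintro s ⟨-, t, -, hst, hcard, -⟩
      have := card_le_card hst
      omega
    · obtain ⟨t, ht, htcard⟩ :=
        hbig ⟨_, Geometry.SimplicialComplex.vertices_subset_space (hfmem i).1⟩
      exact Geometry.SimplicialComplex.exists_mem_skeletonAwayDiff hn hLT ht htcard _
  · exact hgraph _ (hfmem i).1
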